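/- **Systems.** A leader contributor system $\mathcal S=(D,a^0,P_L,P_C)$ consists of a finite data domain $D$ with initial value $a^0\in D$ and two finite automata, the leader $P_L=(Q_L,q_L^0,\delta_L)$ and the contributor $P_C=(Q_C,q_C^0,\delta_C)$, over the operations $!a$ (write) and $?a$ (read), $a\in D$, where $\varepsilon$-transitions are allowed. For a word $w$ of operations, $q\xrightarrow{w}q'$ denotes a run labelled $w$ (with $\varepsilon$-transitions silent). Put $\mathtt L=|Q_L|$, $\mathtt D=|D|$, $\mathtt C=|Q_C|$. **Witnesses.** A witness is a triple $x=(w,q,\sigma)$ with $w=(q_1,a_1)\dots(q_n,a_n)\in(Q_L\times(D\uplus\{\bot\}))^*$, a target $q=:q_{n+1}\in Q_L$ and a monotone (weakly increasing) map $\sigma:[1..k]\to[1..n]$ with $k\le\mathtt D$; $k=\mathrm{ord}(x)$ is its order. It is *short* if $q_1,\dots,q_n$ are pairwise distinct; $\mathrm{Ord}(k)$ is the set of short witnesses of order $k$. A *first-write sequence* is a sequence $\beta$ of at most $\mathtt D$ pairwise distinct elements of $D$. The concatenation is $(w_1,q,\sigma_1)\times(w_2,q',\sigma_2)=(w_1w_2,q',\sigma)$,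 where $\sigma$ lists the values of $\sigma_1$ followed by those of $\sigma_2$ shifted by $|w_1|$. $\mathrm{Shrink}(w,q,\sigma)$ takes the least $r$ such that $q_r=q_s$ for some $s\in[1..n]$, $s\ne r$, and the least such $s$, deletes the letters at positions $r,\dots,s-1$ of $w$, and replaces each value $p$ of $\sigma$ by $p$ if $p<r$, by $r$ if $r\le p\le s$, and by $p-s+r$ if $p>s$; it is the identity on short witnesses. $\mathrm{Shrink}^*$ iterates $\mathrm{Shrink}$ until a fixed point is reached. If the word of $y$ begins in the target state of $x$, put $x\otimes y=\mathrm{Shrink}^*(x\times y)$. **Validity.** For a sequence $\alpha$ let $S_\alpha(i)=\{\alpha_\ell:\sigma(\ell)\le i\}$. * $\mathrm{LValid}_\beta(x)$ holds if $|\beta|=\mathrm{ord}(x)$ and for each $i\in[1..n]$: if $a_i\ne\bot$ then $(q_i,!a_i,q_{i+1})\in\delta_L$; if $a_i=\bot$ then $q_i=q_{i+1}$, or $(q_i,\varepsilon,q_{i+1})\in\delta_L$, or $(q_i,?b,q_{i+1})\in\delta_L$ for some $b\in S_\beta(i)$. * Let $\mathrm{Loop}(p,\Gamma)$ be the set of $b\in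 D$ such that $p\xrightarrow{u\,!b\,v}_L p$ for some words $u,v$ in which only values from $\Gamma$ are read. For $|\alpha|<\mathrm{ord}(x)$ and $j=\sigma(|\alpha|+1)$ let $\mathrm{Expr}(x,\alpha)=\Gamma_1^*\{a_1,\varepsilon\}\Gamma_2^*\{a_2,\varepsilon\}\cdots\Gamma_j^*$ with $\Gamma_i=\mathrm{Loop}(q_i,S_\alpha(i))\cup S_\alpha(i)$, where $a_i=\bot$ is read as $\varepsilon$. * $\mathrm{CValid}^i_\beta(x)$ holds if $|\beta|=\mathrm{ord}(x)$ and there are a run $q_C^0\xrightarrow{v}_C p$ of the contributor and a transition $(p,!\beta_i,p')\in\delta_C$ such that the sequence of values read in $v$ belongs to $\mathrm{Expr}(x,\beta_1\dots\beta_{i-1})$. * For a short witness $z$ and a first-write sequence $\beta$ of length $\mathrm{ord}(z)$, validity $\mathrm{Valid}^{sh}_\beta(z)$ is defined recursively: if $\mathrm{ord}(z)=0$, it is $\mathrm{LValid}_\varepsilon(z)$; if $\mathrm{ord}(z)=k+1$ and $\beta=\beta'\beta_{k+1}$, it holds if and only if there are $x\in\mathrm{Ord}(k)$ and $y\in\mathrm{Ord}(1)$,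 the word of $y$ beginning in the target state of $x$, with $z=x\otimes y$, $\mathrm{LValid}_\beta(x\times y)$, $\mathrm{CValid}^{k+1}_\beta(x\times y)$ and $\mathrm{Valid}^{sh}_{\beta'}(x)$. **Proposition.** The set of all pairs $(\beta,z)$ of a first-write sequence $\beta$ and a short witness $z$ of order $|\beta|$ with $\mathrm{Valid}^{sh}_\beta(z)$ can be computed in time $(\mathtt L+\mathtt D)^{\mathcal O(\mathtt L+\mathtt D)}\cdot\mathtt C^{\mathcal O(1)}$, that is, in time $(\mathtt L+\mathtt D)^{\mathcal O(\mathtt L+\mathtt D)}$ up to a factor polynomial in the size of the contributor. Precisely: there are one deterministic program and one constant $c$ such that for every leader contributor system, given by $\mathtt D,\mathtt L,\mathtt C$ (in unary), its initial memory value and initial states, and lists of its transitions without repetitions and in any order, the program halts after at most $(\mathtt L+\mathtt D)^{c(\mathtt L+\mathtt D)}\cdot\mathtt C^{c}$ steps with a repetition-free list of exactly these pairs. Programs are structured (sequence, branching, while-loop) programs over binary trees with unit-cost pairing, projections and nil-test, a model polynomially equivalent to Turing machines. -/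

import Mathlib

/-! ## Leader contributor systems -/

/-- Memory operations over the data domain `D`: a write `!a` or a read `?a`. -/
inductive MemOp (D : Type) : Type where
  | wr (a : D) : MemOp D
  | rd (a : D) : MemOp D

/-- A thread: an automaton over the memory operations; the label `none` is `ε`. -/
structure Thread (D Q : Type) where
  start : Q
  trans : Set (Q × Option (MemOp D) × Q)

/-- The transition relation extended to words of memory operations (`ε`-transitions are silent). -/
inductive Thread.Run {D Q : Type} (P : Thread D Q) : Q → List (MemOp D) → Q → Prop where
  | refl (q : Q) : Thread.Run P q [] q
  | eps {q q' r : Q} {w : List (MemOp D)} :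
      (q, none, q') ∈ P.trans → Thread.Run P q' w r → Thread.Run P q w r
  | op {q q' r : Q} {o : MemOp D} {w : List (MemOp D)} :
      (q, some o, q') ∈ P.trans → Thread.Run P q' w r → Thread.Run P q (o :: w) r

/-- A leader contributor system with data domain `D`, leader states `QL` and contributor
states `QC`. -/
structure LCSystem (D QL QC : Type) where
  initMem : D
  leader : Thread D QL
  contrib : Thread D QC

/-! ## Witnesses -/

/-- The data of a witness `(w, q, σ)`. The word `w` is a list of leader states paired with an
optional memory value (`none` is `⊥`); the map `σ : [1..k] → [1..n]` is given by the list
`[σ 1, …, σ k]` of its values, and positions in `w` are counted from `1`. -/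
structure Witness (D Q : Type) where
  word : List (Q × Option D)
  target : Q
  pos : List ℕ

namespace Witness

variable {D Q : Type}

/-- The order of a witness: the number of first-write positions. -/
def ord (x : Witness D Q) : ℕ := x.pos.length

/-- `(w, q, σ)` is a witness: `σ` is monotone with values in `[1..n]`, and `k ≤ |D|`. -/
def IsWitness [Fintype D] (x : Witness D Q) : Prop :=
  x.pos.Pairwise (· ≤ ·) ∧ (∀ p ∈ x.pos, 1 ≤ p ∧ p ≤ x.word.length) ∧ x.ord ≤ Fintype.card D

/-- The set `Ord(k)` of short witnesses of order `k`: the leader states in the word are pairwise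
distinct. -/
def shortOfOrder (D Q : Type) [Fintype D] (k : ℕ) : Set (Witness D Q) :=
  {x | x.IsWitness ∧ (x.word.map Prod.fst).Nodup ∧ x.ord = k}

/-- The `i`-th letter `(q_i, a_i)` of the word, for `i ≥ 1`. -/
def letter (x : Witness D Q) (i : ℕ) : Option (Q × Option D) := x.word[i - 1]?

/-- The `i`-th leader state `q_i`, for `1 ≤ i ≤ n + 1`, where `q_{n+1}` is the target. -/
def state (x : Witness D Q) (i : ℕ) : Option Q := (x.word.map Prod.fst ++ [x.target])[i - 1]?

/-- The witness concatenation `x × y`. -/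
def concat (x y : Witness D Q) : Witness D Q where
  word := x.word ++ y.word
  target := y.target
  pos := x.pos ++ y.pos.map (· + x.word.length)

/-- The word of `y` begins in the target state of `x`. -/
def Matches (x y : Witness D Q) : Prop := ∃ a w, y.word = (x.target, a) :: w

/-- The first repetition in a list: the least index `i` whose entry occurs a second time, with the
least index `j > i` of such a second occurrence (indices counted from `0`). -/
def firstRepetition [DecidableEq Q] : List Q → Option (ℕ × ℕ)
  | [] => none
  | q :: l => if q ∈ l then some (0, l.idxOf q + 1)
      else (firstRepetition l).map fun ij => (ij.1 + 1, ij.2 + 1)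

/-- `Shrink`: remove the first repetition of states in the word, if any. With `x = i + 1` and
`y = j + 1` the positions of the repeated state, the letters at `x, …, y - 1` are cut out, a
first-write position in `[x..y]` becomes `x` and a position beyond `y` moves by `y - x`. -/
def shrink [DecidableEq Q] (x : Witness D Q) : Witness D Q :=
  match firstRepetition (x.word.map Prod.fst) with
  | none => x
  | some (i, j) =>
    { word := x.word.take i ++ x.word.drop j
      target := x.target
      pos := x.pos.map fun s => if s < i + 1 then s else if s ≤ j + 1 then i + 1 else s - (j - i) }

/-- `Shrink*`: apply `Shrink` until a fixed point is reached. Each application that is not the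
identity makes the word shorter, so `|w|` applications suffice (see `shrink_shrinkStar`). -/
def shrinkStar [DecidableEq Q] (x : Witness D Q) : Witness D Q := shrink^[x.word.length] x

/-- The short concatenation `x ⊗ y = Shrink*(x × y)`. -/
def shortConcat [DecidableEq Q] (x y : Witness D Q) : Witness D Q := (x.concat y).shrinkStar

theorem firstRepetition_lt [DecidableEq Q] (l : List Q) (i j : ℕ)
    (h : firstRepetition l = some (i, j)) : i < j ∧ j < l.length := by
  induction l generalizing i j with
  | nil => simp [firstRepetition] at h
  | cons q l ih =>
    unfold firstRepetition at h
    split_ifs at h with hq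
    · have := List.idxOf_lt_length_of_mem hq
      simp only [Option.some.injEq, Prod.mk.injEq] at h
      simp only [List.length_cons]
      omega
    · obtain ⟨⟨a, b⟩, hab, he⟩ := Option.map_eq_some_iff.1 h
      have := ih a b hab
      simp only [Prod.mk.injEq] at he
      simp only [List.length_cons]
      omega

theorem shrink_eq_or_lt [DecidableEq Q] (x : Witness D Q) :
    x.shrink = x ∨ x.shrink.word.length < x.word.length := by
  unfold shrink
  split
  · exact Or.inl rfl
  · rename_i i j h
    have := firstRepetition_lt _ _ _ h
    simp only [List.length_map] at this
    right
    simp only [List.length_append, List.length_take, List.length_drop]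
    omega

/-- `Shrink*(x)` is a fixed point of `Shrink`. -/
theorem shrink_shrinkStar [DecidableEq Q] (x : Witness D Q) :
    x.shrinkStar.shrink = x.shrinkStar := by
  have key : ∀ (n : ℕ) (x : Witness D Q), x.word.length ≤ n →
      (shrink^[n] x).shrink = shrink^[n] x := by
    intro n
    induction n with
    | zero =>
      intro x hx
      rcases shrink_eq_or_lt x with h | h
      · exact h
      · omega
    | succ n ih =>
      intro x hx
      rw [Function.iterate_succ_apply]
      rcases shrink_eq_or_lt x with h | h
      · rw [h, Function.iterate_fixed h, h]
      · exact ih _ (by omega)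
  exact key _ x le_rfl

/-- The set `S_α(i) = {α_ℓ | σ(ℓ) ≤ i}` of first writes available at position `i`. -/
def avail (x : Witness D Q) (α : List D) (i : ℕ) : Set D :=
  {b | ∃ ℓ p : ℕ, α[ℓ]? = some b ∧ x.pos[ℓ]? = some p ∧ p ≤ i}

end Witness

/-- The first-write sequences: sequences of length at most `|D|` of pairwise distinct values. -/
def firstWriteSeqs (D : Type) [Fintype D] : Set (List D) :=
  {β | β.Nodup ∧ β.length ≤ Fintype.card D}

/-! ## Validity -/

namespace LCSystem

variable {D QL QC : Type}

/-- `x` is valid for the leader with respect to `β`. -/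
def LValid (S : LCSystem D QL QC) (β : List D) (x : Witness D QL) : Prop :=
  β.length = x.ord ∧
  ∀ (i : ℕ) (q q' : QL) (a : Option D), 1 ≤ i →
    x.letter i = some (q, a) → x.state (i + 1) = some q' →
      match a with
      | some b => (q, some (MemOp.wr b), q') ∈ S.leader.trans
      | none => q = q' ∨ (q, none, q') ∈ S.leader.trans ∨
          ∃ b ∈ x.avail β i, (q, some (MemOp.rd b), q') ∈ S.leader.trans

/-- `Loop(q, Γ)`: the values that the leader can write in a loop at `q` while reading only values
from `Γ`. -/
def loop (S : LCSystem D QL QC) (q : QL) (Γ : Set D) : Set D :=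
  {b | ∃ u v : List (MemOp D), S.leader.Run q (u ++ MemOp.wr b :: v) q ∧
    ∀ d, MemOp.rd d ∈ u ++ MemOp.wr b :: v → d ∈ Γ}

/-- `Γ_i = Loop(q_i, S_α(i)) ∪ S_α(i)`. -/
def gamma (S : LCSystem D QL QC) (x : Witness D QL) (α : List D) (i : ℕ) : Set D :=
  {b | (∃ q a, x.letter i = some (q, a) ∧ b ∈ S.loop q (x.avail α i)) ∨ b ∈ x.avail α i}

open scoped Computability in
/-- The language `Γ_i^*`. -/
def gammaStar (S : LCSystem D QL QC) (x : Witness D QL) (α : List D) (i : ℕ) : Language D :=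
  ({u | ∃ b ∈ S.gamma x α i, u = [b]} : Language D)∗

/-- The language `{a_i, ε}`, where `⊥` is read as `ε`. -/
def optWrite (x : Witness D QL) (i : ℕ) : Language D :=
  {u | u = [] ∨ ∃ q b, x.letter i = some (q, some b) ∧ u = [b]}

/-- `Expr(x, α) = Γ_1^* {a_1, ε} Γ_2^* {a_2, ε} … Γ_j^*` with `j = σ(|α| + 1)`. -/
def expr (S : LCSystem D QL QC) (x : Witness D QL) (α : List D) : Language D :=
  {u | ∃ j, x.pos[α.length]? = some j ∧
    u ∈ ((List.range (j - 1)).map fun i =>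
      S.gammaStar x α (i + 1) * optWrite x (i + 1)).prod * S.gammaStar x α j}

/-- The homomorphism `h` that keeps only the values read. -/
def readsOf (w : List (MemOp D)) : List D :=
  w.filterMap fun o => match o with
    | MemOp.wr _ => none
    | MemOp.rd b => some b

/-- The contributor states that can produce the `i`-th first write `β_i`, for `i ≥ 1`. -/
def writers (S : LCSystem D QL QC) (β : List D) (i : ℕ) : Set QC :=
  {p | ∃ b p', β[i - 1]? = some b ∧ (p, some (MemOp.wr b), p') ∈ S.contrib.trans}

/-- `Trace_C(P)`: the words of memory operations leading a contributor from its initial state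
to `P`. -/
def traceC (S : LCSystem D QL QC) (P : Set QC) : Set (List (MemOp D)) :=
  {w | ∃ p ∈ P, S.contrib.Run S.contrib.start w p}

/-- `x` is valid for the `i`-th first write of `β`, for `1 ≤ i ≤ ord(x) = |β|`:
the languages `Expr(x, β_1 … β_{i-1})` and `h(Trace_C(Q_i))` intersect. -/
def CValidAt (S : LCSystem D QL QC) (i : ℕ) (β : List D) (x : Witness D QL) : Prop :=
  β.length = x.ord ∧ ∃ u, u ∈ S.expr x (β.take (i - 1)) ∧ u ∈ readsOf '' S.traceC (S.writers β i)

/-- The recursion for the validity of short witnesses of order `k` along sequences of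
length `k`. -/
def ValidShOfOrder [Fintype D] [DecidableEq QL] (S : LCSystem D QL QC) :
    ℕ → List D → Witness D QL → Prop
  | 0, β, z => S.LValid β z
  | k + 1, β, z => ∃ x ∈ Witness.shortOfOrder D QL k, ∃ y ∈ Witness.shortOfOrder D QL 1,
      x.Matches y ∧ z = x.shortConcat y ∧ S.LValid β (x.concat y) ∧
      S.CValidAt (k + 1) β (x.concat y) ∧ S.ValidShOfOrder k β.dropLast x

/-- All valid short witnesses for all first-write sequences: the pairs `(β, z)` of a first-write
sequence `β` and a short witness `z` of order `|β|` that is valid along `β`. -/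
def validShortWitnesses [Fintype D] [DecidableEq QL] (S : LCSystem D QL QC) :
    Set (List D × Witness D QL) :=
  {βz | βz.1 ∈ firstWriteSeqs D ∧ βz.2 ∈ Witness.shortOfOrder D QL βz.1.length ∧
    S.ValidShOfOrder βz.1.length βz.1 βz.2}

end LCSystem

/-! ## The machine model: structured programs on binary trees with a step count -/

/-- The data values: binary trees (S-expressions over one atom). -/
inductive Val : Type where
  | nil : Val
  | cons (a b : Val) : Val

/-- Deterministic programs that act on one value, which serves as their store. -/
inductive Prog : Type where
  | skip : Prog
  | nil : Prog
  | fst : Prog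
  | snd : Prog
  | pair (f g : Prog) : Prog
  | seq (f g : Prog) : Prog
  | ite (c f g : Prog) : Prog
  | loop (c f : Prog) : Prog

/-- `p.Runs v w t`: started on `v`, the program `p` halts with result `w` after `t` steps. Each
construct and each test of a loop costs one step on top of its parts. Every step does a bounded
number of pointer operations (it allocates at most one cell, follows one pointer or compares one
pointer with `nil`), so that the step count is polynomially related to that of Turing machines. -/
inductive Prog.Runs : Prog → Val → Val → ℕ → Prop where
  | skip (v : Val) : Prog.Runs Prog.skip v v 1
  | nil (v : Val) : Prog.Runs Prog.nil v Val.nil 1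
  | fst_cons (a b : Val) : Prog.Runs Prog.fst (Val.cons a b) a 1
  | fst_nil : Prog.Runs Prog.fst Val.nil Val.nil 1
  | snd_cons (a b : Val) : Prog.Runs Prog.snd (Val.cons a b) b 1
  | snd_nil : Prog.Runs Prog.snd Val.nil Val.nil 1
  | pair {f g : Prog} {v a b : Val} {s t : ℕ} :
      Prog.Runs f v a s → Prog.Runs g v b t → Prog.Runs (Prog.pair f g) v (Val.cons a b) (s + t + 1)
  | seq {f g : Prog} {v u w : Val} {s t : ℕ} :
      Prog.Runs f v u s → Prog.Runs g u w t → Prog.Runs (Prog.seq f g) v w (s + t + 1)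
  | ite_true {c f g : Prog} {v a b w : Val} {s t : ℕ} :
      Prog.Runs c v (Val.cons a b) s → Prog.Runs f v w t →
      Prog.Runs (Prog.ite c f g) v w (s + t + 1)
  | ite_false {c f g : Prog} {v w : Val} {s t : ℕ} :
      Prog.Runs c v Val.nil s → Prog.Runs g v w t → Prog.Runs (Prog.ite c f g) v w (s + t + 1)
  | loop_stop {c f : Prog} {v : Val} {s : ℕ} :
      Prog.Runs c v Val.nil s → Prog.Runs (Prog.loop c f) v v (s + 1)
  | loop_step {c f : Prog} {v a b u w : Val} {s t r : ℕ} :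
      Prog.Runs c v (Val.cons a b) s → Prog.Runs f v u t → Prog.Runs (Prog.loop c f) u w r →
      Prog.Runs (Prog.loop c f) v w (s + t + r + 1)

/-! ## Encoding of inputs and outputs as trees -/

/-- The standard (injective) encoding of the objects of a type as trees. -/
class ToVal (α : Type) where
  toVal : α → Val

/-- Natural numbers are encoded in unary. -/
def natToVal : ℕ → Val
  | 0 => Val.nil
  | n + 1 => Val.cons Val.nil (natToVal n)

/-- Lists are encoded as right-nested pairs ending in `nil`. -/
def listToVal {α : Type} [ToVal α] : List α → Val
  | [] => Val.nil
  | a :: l => Val.cons (ToVal.toVal a) (listToVal l)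

instance : ToVal ℕ := ⟨natToVal⟩

instance {n : ℕ} : ToVal (Fin n) := ⟨fun i => natToVal i.val⟩

instance {α : Type} [ToVal α] : ToVal (List α) := ⟨listToVal⟩

instance {α β : Type} [ToVal α] [ToVal β] : ToVal (α × β) :=
  ⟨fun x => Val.cons (ToVal.toVal x.1) (ToVal.toVal x.2)⟩

instance {α : Type} [ToVal α] : ToVal (Option α) :=
  ⟨fun o => match o with
    | none => Val.nil
    | some a => Val.cons (ToVal.toVal a) Val.nil⟩

instance {D : Type} [ToVal D] : ToVal (MemOp D) :=
  ⟨fun o => match o with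
    | MemOp.wr a => Val.cons Val.nil (ToVal.toVal a)
    | MemOp.rd a => Val.cons (Val.cons Val.nil Val.nil) (ToVal.toVal a)⟩

instance {D Q : Type} [ToVal D] [ToVal Q] : ToVal (Witness D Q) :=
  ⟨fun x => ToVal.toVal (x.word, x.target, x.pos)⟩

/-- The list `l` enumerates the set `s` without repetitions, in any order. -/
def IsListing {α : Type} (s : Set α) (l : List α) : Prop := l.Nodup ∧ ∀ a, a ∈ l ↔ a ∈ s

/-- The encoding of a system: the sizes of the data domain, of the leader and of the contributor,
the initial memory value and the initial states, and lists of the transitions of the two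
threads. -/
def LCSystem.encode {D L C : ℕ} (S : LCSystem (Fin D) (Fin L) (Fin C))
    (transL : List (Fin L × Option (MemOp (Fin D)) × Fin L))
    (transC : List (Fin C × Option (MemOp (Fin D)) × Fin C)) : Val :=
  ToVal.toVal ((D, S.initMem), (L, S.leader.start, transL), (C, S.contrib.start, transC))

open ToVal

set_option linter.unusedSectionVars false

/-! The algorithm is dynamic programming over all candidate pairs. A short witness repeats no state,
so its word has at most `L` letters from an alphabet of size `L * (D + 1)`, and its map is a list of
at most `D` numbers up to `L`. A first-write sequence is a list of at most `D` values. There are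
thus only `(L + D) ^ O(L + D)` candidates, and the contributor does not enter their number. Validity
of `(β, z)` refers only to validity along `β.dropLast`, so `D + 1` rounds of filtering the
candidates suffice (`isListing_validList`). A round tests each candidate against all pairs `x`, `y`
of short witnesses.

Each test is polynomial. Leader validity is a local check. For contributor validity, `Expr` is a
product of simple factors, and the set of states reached while reading a product arises by applying
the factors one after the other (`Thread.post_mul`). Each factor, and likewise each `Loop` set,
reduces to graph reachability (`mem_reachable`, `mem_loopList`, `setOf_mem_reach_exprStates`).

The running time is obtained from closure properties. `PolyTime` speaks of families of functions
over an index set, computed by one program for all indices; it is closed under composition, case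
distinction, bounded loops and list operations. It tracks the size of results besides the time,
because unit-cost pairing shares subtrees and a tree can be exponentially larger than the number of
steps that built it.

The exponential factor is handled by padding. The input is preceded by `(L + D) ^ (L + D)` in unary;
relative to the padded size the enumeration of all candidates, and with it the whole algorithm, is
polynomial (`polyTime_validList`). The padding is computed in time polynomial in the padded size
(`exists_pad_prog`). That size is at most `((L + D) ^ (L + D) * C) ^ 9` (`PaddedInput.sz_le`), and a
fixed power of this has the required form. -/

theorem Prog.Runs.loop_exit {c f : Prog} {v : Val} {s : ℕ} (h : c.Runs v Val.nil s) :
    (Prog.loop c f).Runs v v (s + 1) := by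
  constructor
  exact h

/-! ## Polynomially bounded functions and polynomial-time programs -/

instance : ToVal Val := ⟨id⟩

instance : ToVal Bool := ⟨fun b => cond b (Val.cons Val.nil Val.nil) Val.nil⟩

/-- The size of a tree, normalized such that it is additive and at least `2`. -/
def Val.size : Val → ℕ
  | Val.nil => 2
  | Val.cons a b => a.size + b.size

theorem Val.two_le_size (v : Val) : 2 ≤ v.size := by
  induction v with
  | nil => simp [Val.size]
  | cons a b iha ihb => simp only [Val.size]; omega

/-- The size of the encoding of an object. -/
def sz {α : Type} [ToVal α] (a : α) : ℕ := (toVal a).size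

theorem two_le_sz {α : Type} [ToVal α] (a : α) : 2 ≤ sz a := Val.two_le_size _

theorem sz_prod {α β : Type} [ToVal α] [ToVal β] (a : α) (b : β) : sz (a, b) = sz a + sz b := rfl

section Families

variable {I : Type} {A B C D S : I → Type}
variable [∀ i, ToVal (A i)] [∀ i, ToVal (B i)] [∀ i, ToVal (C i)] [∀ i, ToVal (D i)]
variable [∀ i, ToVal (S i)]

/-- A family of functions that is bounded by a polynomial in the size of the argument. -/
def PolyBounded (T : ∀ i, A i → ℕ) : Prop := ∃ c, ∀ i a, T i a ≤ sz a ^ c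

namespace PolyBounded

theorem mono {T U : ∀ i, A i → ℕ} (hU : PolyBounded U) (h : ∀ i a, T i a ≤ U i a) :
    PolyBounded T :=
  let ⟨c, hc⟩ := hU
  ⟨c, fun i a => (h i a).trans (hc i a)⟩

/-- Sizes are at least `2`, so `n ≤ 2 ^ n` is below a pure power of the size. This is why polynomial
bounds need neither coefficients nor additive constants. -/
theorem const (n : ℕ) : PolyBounded (fun i (_ : A i) => n) :=
  ⟨n, fun _ a => (Nat.lt_pow_self (two_le_sz a)).le⟩

theorem self : PolyBounded (fun i (a : A i) => sz a) := ⟨1, fun _ a => by simp⟩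

theorem mul {T U : ∀ i, A i → ℕ} (hT : PolyBounded T) (hU : PolyBounded U) :
    PolyBounded (fun i a => T i a * U i a) :=
  let ⟨c, hc⟩ := hT
  let ⟨d, hd⟩ := hU
  ⟨c + d, fun i a => by rw [pow_add]; exact Nat.mul_le_mul (hc i a) (hd i a)⟩

theorem add {T U : ∀ i, A i → ℕ} (hT : PolyBounded T) (hU : PolyBounded U) :
    PolyBounded (fun i a => T i a + U i a) := by
  obtain ⟨c, hc⟩ := hT
  obtain ⟨d, hd⟩ := hU
  refine ⟨c + d + 1, fun i a => ?_⟩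
  have h2 := two_le_sz a
  have h1 : sz a ^ c ≤ sz a ^ (c + d) := Nat.pow_le_pow_right (by omega) (by omega)
  have h3 : sz a ^ d ≤ sz a ^ (c + d) := Nat.pow_le_pow_right (by omega) (by omega)
  rw [pow_succ]
  nlinarith [hc i a, hd i a]

theorem pow {T : ∀ i, A i → ℕ} (hT : PolyBounded T) (n : ℕ) :
    PolyBounded (fun i a => T i a ^ n) :=
  let ⟨c, hc⟩ := hT
  ⟨c * n, fun i a => by rw [pow_mul]; exact Nat.pow_le_pow_left (hc i a) n⟩

theorem comp {T : ∀ i, B i → ℕ} {f : ∀ i, A i → B i} (hT : PolyBounded T)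
    (hf : PolyBounded (fun i a => sz (f i a))) : PolyBounded (fun i a => T i (f i a)) :=
  let ⟨c, hc⟩ := hT
  (hf.pow c).mono fun i a => hc i (f i a)

end PolyBounded

/-- A family of functions that a single program computes in polynomial time, with results of
polynomial size. -/
structure PolyTime (f : ∀ i, A i → B i) : Prop where
  runs : ∃ (p : Prog) (T : ∀ i, A i → ℕ), PolyBounded T ∧
    ∀ i a, ∃ t ≤ T i a, p.Runs (toVal a) (toVal (f i a)) t
  size : PolyBounded (fun i a => sz (f i a))

namespace PolyTime

/-- Programs see only encodings, so the type of the result is irrelevant. Constructors and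
projections of all data types are obtained in this way from operations on trees. -/
theorem congrVal {f : ∀ i, A i → B i} {g : ∀ i, A i → C i} (hf : PolyTime f)
    (h : ∀ i a, toVal (f i a) = toVal (g i a)) : PolyTime g where
  runs := by
    obtain ⟨p, T, hT, hp⟩ := hf.runs
    exact ⟨p, T, hT, fun i a => by rw [← h]; exact hp i a⟩
  size := hf.size.mono fun i a => by unfold sz; rw [h]

theorem congr {f g : ∀ i, A i → B i} (hf : PolyTime f) (h : ∀ i a, f i a = g i a) : PolyTime g :=
  hf.congrVal fun i a => by rw [h]

theorem val {f : ∀ i, A i → B i} (h : PolyTime f) : PolyTime (fun i a => toVal (f i a)) :=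
  h.congrVal fun _ _ => rfl

theorem id : PolyTime (fun i (a : A i) => a) where
  runs := ⟨Prog.skip, fun _ _ => 1, .const 1, fun _ _ => ⟨1, le_rfl, .skip _⟩⟩
  size := .self

theorem comp {g : ∀ i, B i → C i} {f : ∀ i, A i → B i} (hg : PolyTime g) (hf : PolyTime f) :
    PolyTime (fun i a => g i (f i a)) where
  runs := by
    obtain ⟨p, T, hT, hp⟩ := hf.runs
    obtain ⟨q, U, hU, hq⟩ := hg.runs
    refine ⟨.seq p q, fun i a => T i a + U i (f i a) + 1, (hT.add (hU.comp hf.size)).add (.const 1),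
      fun i a => ?_⟩
    obtain ⟨s, hs, h1⟩ := hp i a
    obtain ⟨t, ht, h2⟩ := hq i (f i a)
    exact ⟨s + t + 1, by dsimp only; omega, h1.seq h2⟩
  size := hg.size.comp hf.size

theorem pair {f : ∀ i, A i → B i} {g : ∀ i, A i → C i} (hf : PolyTime f) (hg : PolyTime g) :
    PolyTime (fun i a => (f i a, g i a)) where
  runs := by
    obtain ⟨p, T, hT, hp⟩ := hf.runs
    obtain ⟨q, U, hU, hq⟩ := hg.runs
    refine ⟨.pair p q, fun i a => T i a + U i a + 1, (hT.add hU).add (.const 1), fun i a => ?_⟩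
    obtain ⟨s, hs, h1⟩ := hp i a
    obtain ⟨t, ht, h2⟩ := hq i a
    exact ⟨s + t + 1, by dsimp only; omega, h1.pair h2⟩
  size := hf.size.add hg.size

theorem vnil : PolyTime (fun i (_ : A i) => Val.nil) where
  runs := ⟨.nil, fun _ _ => 1, .const 1, fun _ _ => ⟨1, le_rfl, .nil _⟩⟩
  size := (PolyBounded.const 2).mono fun _ _ => le_rfl

theorem vcons {f g : ∀ i, A i → Val} (hf : PolyTime f) (hg : PolyTime g) :
    PolyTime (fun i a => Val.cons (f i a) (g i a)) :=
  (hf.pair hg).congrVal fun _ _ => rfl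

theorem const (v : Val) : PolyTime (fun i (_ : A i) => v) := by
  induction v with
  | nil => exact vnil
  | cons a b iha ihb => exact iha.vcons ihb

end PolyTime

/-- The first component of a tree. -/
def Val.left : Val → Val
  | Val.nil => Val.nil
  | Val.cons a _ => a

/-- The second component of a tree. -/
def Val.right : Val → Val
  | Val.nil => Val.nil
  | Val.cons _ b => b

/-- The test whether a tree is not `nil`. -/
def Val.isCons : Val → Bool
  | Val.nil => false
  | Val.cons _ _ => true

/-! ### Projections, case distinction and loops -/

namespace PolyTime

theorem vleft {f : ∀ i, A i → Val} (hf : PolyTime f) : PolyTime (fun i a => (f i a).left) := by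
  refine comp (g := fun _ v => Val.left v) ?_ hf
  refine ⟨⟨.fst, fun _ _ => 1, .const 1, fun i a => ⟨1, le_rfl, ?_⟩⟩, PolyBounded.self.mono ?_⟩
  · cases a
    · exact .fst_nil
    · exact .fst_cons _ _
  · intro i a
    cases a
    · exact le_rfl
    · exact Nat.le_add_right _ _

theorem vright {f : ∀ i, A i → Val} (hf : PolyTime f) : PolyTime (fun i a => (f i a).right) := by
  refine comp (g := fun _ v => Val.right v) ?_ hf
  refine ⟨⟨.snd, fun _ _ => 1, .const 1, fun i a => ⟨1, le_rfl, ?_⟩⟩, PolyBounded.self.mono ?_⟩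
  · cases a
    · exact .snd_nil
    · exact .snd_cons _ _
  · intro i a
    cases a
    · exact le_rfl
    · exact Nat.le_add_left _ _

theorem fst {f : ∀ i, A i → B i × C i} (hf : PolyTime f) : PolyTime (fun i a => (f i a).1) :=
  hf.val.vleft.congrVal fun _ _ => rfl

theorem snd {f : ∀ i, A i → B i × C i} (hf : PolyTime f) : PolyTime (fun i a => (f i a).2) :=
  hf.val.vright.congrVal fun _ _ => rfl

theorem cond {c : ∀ i, A i → Bool} {f g : ∀ i, A i → B i} (hc : PolyTime c) (hf : PolyTime f)
    (hg : PolyTime g) : PolyTime (fun i a => cond (c i a) (f i a) (g i a)) where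
  runs := by
    obtain ⟨p, T, hT, hp⟩ := hf.runs
    obtain ⟨q, U, hU, hq⟩ := hg.runs
    obtain ⟨r, V, hV, hr⟩ := hc.runs
    refine ⟨.ite r p q, fun i a => V i a + (T i a + U i a) + 1, (hV.add (hT.add hU)).add (.const 1),
      fun i a => ?_⟩
    obtain ⟨s, hs, h1⟩ := hp i a
    obtain ⟨t, ht, h2⟩ := hq i a
    obtain ⟨u, hu, h3⟩ := hr i a
    rcases h : c i a with _ | _ <;> rw [h] at h3
    · exact ⟨u + t + 1, by dsimp only; omega, .ite_false h3 h2⟩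
    · exact ⟨u + s + 1, by dsimp only; omega, .ite_true h3 h1⟩
  size := (hf.size.add hg.size).mono fun i a => by cases c i a <;> simp

/-- Case distinction on an option; the second branch sees the content of the option. -/
theorem optionElim {o : ∀ i, A i → Option (B i)} {n : ∀ i, A i → C i} {g : ∀ i, A i → B i → C i}
    (ho : PolyTime o) (hn : PolyTime n) (hg : PolyTime (fun i (p : A i × B i) => g i p.1 p.2)) :
    PolyTime (fun i a => (o i a).elim (n i a) (g i a)) where
  runs := by
    obtain ⟨p, T, hT, hp⟩ := ho.runs
    obtain ⟨q, U, hU, hq⟩ := hn.runs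
    obtain ⟨r, V, ⟨k, hk⟩, hr⟩ := hg.runs
    -- The option is evaluated twice: as the test, and again to place its content next to the
    -- argument. `some b` is a pair with first component `b`, hence never `nil`.
    refine ⟨.ite p (.seq (.pair .skip (.seq p .fst)) r) q,
      fun i a => T i a + (T i a + (sz a + sz (o i a)) ^ k + 7 + U i a) + 1,
      (hT.add (((hT.add ((PolyBounded.self.add ho.size).pow k)).add (.const 7)).add hU)).add
        (.const 1), fun i a => ?_⟩
    obtain ⟨s, hs, h1⟩ := hp i a
    obtain ⟨t, ht, h2⟩ := hq i a
    rcases h : o i a with _ | b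
    · rw [h] at h1
      exact ⟨s + t + 1, by dsimp only; omega, .ite_false h1 h2⟩
    · obtain ⟨u, hu, h3⟩ := hr i (a, b)
      have hb : V i (a, b) ≤ (sz a + sz (some b)) ^ k :=
        (hk i (a, b)).trans (Nat.pow_le_pow_left (Nat.add_le_add_left (Nat.le_add_right _ _) _) _)
      rw [h] at h1
      refine ⟨s + (1 + (s + 1 + 1) + 1 + u + 1) + 1, by dsimp only; rw [h]; omega,
        .ite_true h1 (.seq (.pair (.skip _) (.seq h1 (.fst_cons _ _))) h3)⟩
  size := by
    obtain ⟨k, hk⟩ := hg.size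
    refine (hn.size.add ((PolyBounded.self.add ho.size).pow k)).mono fun i a => ?_
    rcases h : o i a with _ | b
    · exact Nat.le_add_right _ _
    · have hb : sz (g i a b) ≤ (sz a + sz (some b)) ^ k :=
        (hk i (a, b)).trans (Nat.pow_le_pow_left (Nat.add_le_add_left (Nat.le_add_right _ _) _) _)
      exact hb.trans (Nat.le_add_left _ _)

/-- A loop whose states satisfy an invariant that bounds their size. -/
theorem whileLoop {c : ∀ i, S i → Bool} {f : ∀ i, S i → S i} {init : ∀ i, A i → S i}
    {out : ∀ i, S i → B i} {g : ∀ i, A i → B i}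
    (Inv : ∀ i, A i → S i → Prop) (Φ : ∀ i, S i → ℕ)
    (hc : PolyTime c) (hf : PolyTime f) (hinit : PolyTime init) (hout : PolyTime out)
    (h0 : ∀ i a, Inv i a (init i a))
    (hstep : ∀ i a s, Inv i a s → c i s = true → Inv i a (f i s) ∧ Φ i (f i s) < Φ i s)
    (hend : ∀ i a s, Inv i a s → c i s = false → out i s = g i a)
    (hsz : ∃ k, ∀ i a s, Inv i a s → sz s ≤ sz a ^ k)
    (hΦ : PolyBounded (fun i a => Φ i (init i a))) : PolyTime g := by
  obtain ⟨k, hk⟩ := hsz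
  -- The invariant bounds every state polynomially in the original argument, so a bound in the size
  -- of the state becomes one in the size of the argument.
  have key : ∀ {T : ∀ i, S i → ℕ}, PolyBounded T →
      ∃ c, ∀ i a s, Inv i a s → T i s ≤ sz a ^ c := by
    rintro T ⟨c, hc⟩
    refine ⟨k * c, fun i a s hs => (hc i s).trans ?_⟩
    rw [pow_mul]
    exact Nat.pow_le_pow_left (hk i a s hs) c
  obtain ⟨pc, Tc, hTc, hpc⟩ := hc.runs
  obtain ⟨pf, Tf, hTf, hpf⟩ := hf.runs
  obtain ⟨pi, Ti, hTi, hpi⟩ := hinit.runs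
  obtain ⟨po, To, hTo, hpo⟩ := hout.runs
  obtain ⟨kc, hkc⟩ := key hTc
  obtain ⟨kf, hkf⟩ := key hTf
  obtain ⟨ko, hko⟩ := key hTo
  obtain ⟨ks, hks⟩ := key hout.size
  -- The measure bounds the number of passes; the extra unit in `n + 1` pays for the final failing
  -- test.
  have hloop : ∀ i a n s, Φ i s ≤ n → Inv i a s → ∃ s' t, Inv i a s' ∧ c i s' = false ∧
      (Prog.loop pc pf).Runs (toVal s) (toVal s') t ∧
      t ≤ (n + 1) * (sz a ^ kc + sz a ^ kf + 1) := by
    intro i a n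
    induction n with
    | zero =>
      intro s hn hs
      rcases h : c i s with _ | _
      · obtain ⟨t, ht, h1⟩ := hpc i s
        have := hkc i a s hs
        rw [h] at h1
        exact ⟨s, t + 1, hs, h, .loop_exit h1, by omega⟩
      · have := (hstep i a s hs h).2
        omega
    | succ n ih =>
      intro s hn hs
      obtain ⟨t, ht, h1⟩ := hpc i s
      have e1 := hkc i a s hs
      rcases h : c i s with _ | _ <;> rw [h] at h1
      · refine ⟨s, t + 1, hs, h, .loop_exit h1, ?_⟩
        calc t + 1 ≤ 1 * (sz a ^ kc + sz a ^ kf + 1) := by omega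
          _ ≤ _ := Nat.mul_le_mul_right _ (by omega)
      · obtain ⟨u, hu, h2⟩ := hpf i s
        have e2 := hkf i a s hs
        obtain ⟨h3, h4⟩ := hstep i a s hs h
        obtain ⟨s', r, h5, h6, h7, h8⟩ := ih (f i s) (by omega) h3
        refine ⟨s', t + u + r + 1, h5, h6, .loop_step h1 h2 h7, ?_⟩
        rw [Nat.add_mul (n + 1) 1, Nat.one_mul]
        omega
  constructor
  · refine ⟨.seq pi (.seq (.loop pc pf) po), fun i a => Ti i a +
      ((Φ i (init i a) + 1) * (sz a ^ kc + sz a ^ kf + 1) + sz a ^ ko + 1) + 1, ?_, fun i a => ?_⟩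
    · exact (hTi.add ((((hΦ.add (.const 1)).mul (((PolyBounded.self.pow kc).add
        (PolyBounded.self.pow kf)).add (.const 1))).add (PolyBounded.self.pow ko)).add
        (.const 1))).add (.const 1)
    · obtain ⟨t, ht, h1⟩ := hpi i a
      obtain ⟨s', r, h5, h6, h7, h8⟩ := hloop i a _ (init i a) le_rfl (h0 i a)
      obtain ⟨u, hu, h9⟩ := hpo i s'
      have := hko i a s' h5
      rw [hend i a s' h5 h6] at h9
      exact ⟨t + (r + u + 1) + 1, by dsimp only; omega, h1.seq (h7.seq h9)⟩
  · refine ⟨ks, fun i a => ?_⟩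
    obtain ⟨s', r, h5, h6, h7, h8⟩ := hloop i a _ (init i a) le_rfl (h0 i a)
    dsimp only
    rw [← hend i a s' h5 h6]
    exact hks i a s' h5

end PolyTime

end Families

/-! ## Polynomial-time operations on options, numbers and lists -/

theorem sz_nil {α : Type} [ToVal α] : sz ([] : List α) = 2 := rfl

theorem sz_cons {α : Type} [ToVal α] (a : α) (l : List α) : sz (a :: l) = sz a + sz l := rfl

theorem sz_succ (n : ℕ) : sz (n + 1) = 2 + sz n := rfl

theorem sz_none {α : Type} [ToVal α] : sz (none : Option α) = 2 := rfl

theorem sz_nat (n : ℕ) : sz n = 2 * n + 2 := by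
  induction n with
  | zero => rfl
  | succ n ih => rw [sz_succ]; omega

theorem sz_list {α : Type} [ToVal α] (l : List α) : sz l = 2 + (l.map sz).sum := by
  induction l with
  | nil => rfl
  | cons a l ih => rw [sz_cons, ih, List.map_cons, List.sum_cons]; omega

theorem sz_append {α : Type} [ToVal α] (l m : List α) : sz (l ++ m) + 2 = sz l + sz m := by
  simp only [sz_list, List.map_append, List.sum_append]; omega

theorem List.Sublist.sz_le {α : Type} [ToVal α] {l m : List α} (h : l.Sublist m) :
    sz l ≤ sz m := by
  induction h with
  | slnil => exact le_rfl
  | cons a _ ih => rw [sz_cons]; omega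
  | cons_cons a _ ih => simp only [sz_cons]; omega

theorem sz_le_of_mem {α : Type} [ToVal α] {l : List α} {a : α} (h : a ∈ l) : sz a ≤ sz l := by
  have := (List.singleton_sublist.2 h).sz_le
  rw [sz_cons] at this
  omega

theorem length_le_sz {α : Type} [ToVal α] (l : List α) : 2 * l.length + 2 ≤ sz l := by
  induction l with
  | nil => exact le_rfl
  | cons a l ih => rw [sz_cons, List.length_cons]; have := two_le_sz a; omega

theorem sz_list_le {α : Type} [ToVal α] {l : List α} {m : ℕ} (h : ∀ a ∈ l, sz a ≤ m) :
    sz l ≤ 2 + l.length * m := by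
  induction l with
  | nil => simp [sz_nil]
  | cons a l ih =>
    have h1 := ih fun b hb => h b (List.mem_cons_of_mem _ hb)
    have h2 := h a List.mem_cons_self
    rw [sz_cons, List.length_cons, Nat.add_mul]
    omega

theorem sz_bool_le (b : Bool) : sz b ≤ 4 := by cases b <;> simp [sz, toVal, Val.size]

namespace PolyTime

variable {I : Type} {A B C D S : I → Type}
variable [∀ i, ToVal (A i)] [∀ i, ToVal (B i)] [∀ i, ToVal (C i)] [∀ i, ToVal (D i)]
variable [∀ i, ToVal (S i)]

theorem false : PolyTime (fun i (_ : A i) => false) := vnil.congrVal fun _ _ => rfl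

theorem true : PolyTime (fun i (_ : A i) => true) := (vnil.vcons vnil).congrVal fun _ _ => rfl

theorem nil : PolyTime (fun i (_ : A i) => ([] : List (B i))) := vnil.congrVal fun _ _ => rfl

theorem none : PolyTime (fun i (_ : A i) => (none : Option (B i))) := vnil.congrVal fun _ _ => rfl

theorem some {f : ∀ i, A i → B i} (hf : PolyTime f) : PolyTime (fun i a => some (f i a)) :=
  (hf.val.vcons vnil).congrVal fun _ _ => rfl

theorem succ {f : ∀ i, A i → ℕ} (hf : PolyTime f) : PolyTime (fun i a => f i a + 1) :=
  (vnil.vcons hf.val).congrVal fun _ _ => rfl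

theorem natConst (n : ℕ) : PolyTime (fun i (_ : A i) => n) :=
  (const (toVal n)).congrVal fun _ _ => rfl

theorem cons {f : ∀ i, A i → B i} {l : ∀ i, A i → List (B i)} (hf : PolyTime f)
    (hl : PolyTime l) : PolyTime (fun i a => f i a :: l i a) :=
  (hf.val.vcons hl.val).congrVal fun _ _ => rfl

theorem and {f g : ∀ i, A i → Bool} (hf : PolyTime f) (hg : PolyTime g) :
    PolyTime (fun i a => f i a && g i a) :=
  (hf.cond hg false).congr fun i a => by cases f i a <;> rfl

theorem or {f g : ∀ i, A i → Bool} (hf : PolyTime f) (hg : PolyTime g) :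
    PolyTime (fun i a => f i a || g i a) :=
  (hf.cond true hg).congr fun i a => by cases f i a <;> rfl

theorem not {f : ∀ i, A i → Bool} (hf : PolyTime f) : PolyTime (fun i a => !f i a) :=
  (hf.cond false true).congr fun i a => by cases f i a <;> rfl

theorem visCons {f : ∀ i, A i → Val} (hf : PolyTime f) : PolyTime (fun i a => (f i a).isCons) := by
  refine comp (g := fun _ v => Val.isCons v) ?_ hf
  refine ⟨⟨.ite .skip (.pair .nil .nil) .nil, fun _ _ => 5, .const 5, fun i a => ?_⟩,
    (PolyBounded.const 4).mono fun _ _ => sz_bool_le _⟩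
  cases a
  · exact ⟨1 + 1 + 1, by norm_num, .ite_false (.skip _) (.nil _)⟩
  · exact ⟨1 + (1 + 1 + 1) + 1, by norm_num, .ite_true (.skip _) (.pair (.nil _) (.nil _))⟩

theorem isSome {o : ∀ i, A i → Option (B i)} (ho : PolyTime o) :
    PolyTime (fun i a => (o i a).isSome) :=
  ho.val.visCons.congr fun i a => by cases o i a <;> rfl

theorem isEmpty {l : ∀ i, A i → List (B i)} (hl : PolyTime l) :
    PolyTime (fun i a => (l i a).isEmpty) :=
  hl.val.visCons.not.congr fun i a => by cases l i a <;> rfl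

theorem head? {l : ∀ i, A i → List (B i)} (hl : PolyTime l) :
    PolyTime (fun i a => (l i a).head?) :=
  (hl.val.visCons.cond (hl.val.vleft.vcons vnil) vnil).congrVal fun i a => by
    cases l i a <;> rfl

theorem tail {l : ∀ i, A i → List (B i)} (hl : PolyTime l) : PolyTime (fun i a => (l i a).tail) :=
  hl.val.vright.congrVal fun i a => by cases l i a <;> rfl

theorem pred {f : ∀ i, A i → ℕ} (hf : PolyTime f) : PolyTime (fun i a => f i a - 1) :=
  hf.val.vright.congrVal fun i a => by cases f i a <;> rfl

theorem decideEqZero {f : ∀ i, A i → ℕ} (hf : PolyTime f) :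
    PolyTime (fun i a => decide (f i a = 0)) :=
  hf.val.visCons.not.congr fun i a => by cases f i a <;> rfl

theorem optionMap {o : ∀ i, A i → Option (B i)} {g : ∀ i, A i → B i → C i} (ho : PolyTime o)
    (hg : PolyTime (fun i (p : A i × B i) => g i p.1 p.2)) :
    PolyTime (fun i a => (o i a).map (g i a)) :=
  (optionElim (g := fun i a b => Option.some (g i a b)) ho none hg.some).congr fun i a => by
    cases o i a <;> rfl

/-- The size hypothesis is essential: a polynomial-time step can square the size of the accumulator
in every pass. It is imposed on all prefixes, since these give the intermediate states of the loop.
-/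
theorem foldl {l : ∀ i, A i → List (B i)} {init : ∀ i, A i → S i}
    {step : ∀ i, A i → S i → B i → S i} (hl : PolyTime l) (hinit : PolyTime init)
    (hstep : PolyTime (fun i (p : (A i × S i) × B i) => step i p.1.1 p.1.2 p.2))
    (hsz : ∃ k, ∀ i a l', l' <+: l i a → sz (l'.foldl (step i a) (init i a)) ≤ sz a ^ k) :
    PolyTime (fun i a => (l i a).foldl (step i a) (init i a)) := by
  obtain ⟨k, hk⟩ := hsz
  refine whileLoop (S := fun i => A i × S i × List (B i))
    (c := fun i s => !s.2.2.isEmpty)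
    (f := fun i s => s.2.2.head?.elim s fun b => (s.1, step i s.1 s.2.1 b, s.2.2.tail))
    (init := fun i a => (a, init i a, l i a)) (out := fun i s => s.2.1)
    (fun i a s => s.1 = a ∧ ∃ m, m ++ s.2.2 = l i a ∧ m.foldl (step i a) (init i a) = s.2.1)
    (fun i s => s.2.2.length) id.snd.snd.isEmpty.not ?_ (id.pair (hinit.pair hl)) id.snd.fst
    (fun i a => ⟨rfl, [], rfl, rfl⟩) ?_ ?_ ?_ (hl.size.mono fun i a => ?_)
  · refine optionElim (g := fun i (s : A i × S i × List (B i)) b =>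
      (s.1, step i s.1 s.2.1 b, s.2.2.tail)) id.snd.snd.head? id ?_
    exact id.fst.fst.pair (((hstep.comp ((id.fst.fst.pair id.fst.snd.fst).pair id.snd))).pair
      id.fst.snd.snd.tail)
  · rintro i a ⟨a', s, r⟩ ⟨rfl, m, h1, h2⟩ hc
    dsimp only at h1 h2 hc ⊢
    cases r with
    | nil => simp at hc
    | cons b r =>
      refine ⟨⟨rfl, m ++ [b], ?_, ?_⟩, ?_⟩
      · simpa using h1
      · simp [List.foldl_append, h2]
      · simp
  · rintro i a ⟨a', s, r⟩ ⟨rfl, m, h1, h2⟩ hc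
    dsimp only at h1 h2 hc ⊢
    cases r with
    | nil => rw [← h2, ← h1, List.append_nil]
    | cons b r => simp at hc
  · obtain ⟨c, hc⟩ := (PolyBounded.self.add ((PolyBounded.self.pow k).add hl.size) :
      PolyBounded (fun i (a : A i) => sz a + (sz a ^ k + sz (l i a))))
    refine ⟨c, ?_⟩
    rintro i a ⟨a', s, r⟩ ⟨rfl, m, h1, h2⟩
    dsimp only at h1 h2
    refine le_trans ?_ (hc i a')
    have e1 := hk i a' m ⟨r, h1⟩
    have e2 : sz r ≤ sz (l i a') := by
      rw [← h1]
      exact (List.sublist_append_right m r).sz_le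
    rw [h2] at e1
    simp only [sz_prod]
    omega
  · dsimp only
    have := length_le_sz (l i a)
    omega

/-- The increment in each step is bounded independently of the accumulator, so the total growth is
at most the length of the list times a polynomial. -/
theorem foldl_of_le_add {l : ∀ i, A i → List (B i)} {init : ∀ i, A i → S i}
    {step : ∀ i, A i → S i → B i → S i} (hl : PolyTime l) (hinit : PolyTime init)
    (hstep : PolyTime (fun i (p : (A i × S i) × B i) => step i p.1.1 p.1.2 p.2))
    (hsz : ∃ k, ∀ i a s b, sz (step i a s b) ≤ sz s + (sz a + sz b) ^ k) :
    PolyTime (fun i a => (l i a).foldl (step i a) (init i a)) := by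
  refine foldl hl hinit hstep ?_
  obtain ⟨k, hk⟩ := hsz
  obtain ⟨c, hc⟩ := hinit.size.add (hl.size.mul ((PolyBounded.self.add hl.size).pow k))
  refine ⟨c, fun i a l' hl' => le_trans ?_ (hc i a)⟩
  have key : ∀ (m : List (B i)) (s : S i) (M : ℕ), (∀ b ∈ m, sz b ≤ M) →
      sz (m.foldl (step i a) s) ≤ sz s + m.length * (sz a + M) ^ k := by
    intro m s M hM
    induction m generalizing s with
    | nil => simp
    | cons b m ih =>
      have h1 := ih (step i a s b) fun b' hb' => hM b' (List.mem_cons_of_mem _ hb')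
      have h2 := hk i a s b
      have h3 : (sz a + sz b) ^ k ≤ (sz a + M) ^ k :=
        Nat.pow_le_pow_left (Nat.add_le_add_left (hM b List.mem_cons_self) _) _
      rw [List.foldl_cons, List.length_cons, Nat.add_mul]
      omega
  refine (key l' _ (sz (l i a)) fun b hb => sz_le_of_mem (hl'.subset hb)).trans ?_
  refine Nat.add_le_add_left (Nat.mul_le_mul_right _ ?_) _
  have := length_le_sz (l i a)
  have := hl'.length_le
  omega

theorem reverse {l : ∀ i, A i → List (B i)} (hl : PolyTime l) :
    PolyTime (fun i a => (l i a).reverse) := by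
  refine (foldl_of_le_add (step := fun i _ s b => b :: s) hl nil (id.snd.cons id.fst.snd)
    ⟨1, fun i a s b => ?_⟩).congr fun i a => ?_
  · rw [sz_cons, pow_one]; omega
  · simp

theorem append {l m : ∀ i, A i → List (B i)} (hl : PolyTime l) (hm : PolyTime m) :
    PolyTime (fun i a => l i a ++ m i a) := by
  refine (foldl_of_le_add (step := fun i _ s b => b :: s) hl.reverse hm (id.snd.cons id.fst.snd)
    ⟨1, fun i a s b => ?_⟩).congr fun i a => ?_
  · rw [sz_cons, pow_one]; omega
  · simp

theorem flatMap {l : ∀ i, A i → List (B i)} {g : ∀ i, A i → B i → List (C i)} (hl : PolyTime l)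
    (hg : PolyTime (fun i (p : A i × B i) => g i p.1 p.2)) :
    PolyTime (fun i a => (l i a).flatMap (g i a)) := by
  obtain ⟨k, hk⟩ := hg.size
  refine (foldl_of_le_add (step := fun i a s b => s ++ g i a b) hl nil
    (id.fst.snd.append (hg.comp (id.fst.fst.pair id.snd))) ⟨k, fun i a s b => ?_⟩).congr
    fun i a => ?_
  · have h1 := hk i (a, b)
    have h2 := sz_append s (g i a b)
    rw [sz_prod] at h1
    dsimp only at h1
    omega
  · rw [List.flatMap_eq_foldl]

theorem map {l : ∀ i, A i → List (B i)} {g : ∀ i, A i → B i → C i} (hl : PolyTime l)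
    (hg : PolyTime (fun i (p : A i × B i) => g i p.1 p.2)) :
    PolyTime (fun i a => (l i a).map (g i a)) :=
  (flatMap (g := fun i a b => [g i a b]) hl (hg.cons nil)).congr fun i a => by
    rw [List.map_eq_flatMap]

theorem filter {l : ∀ i, A i → List (B i)} {g : ∀ i, A i → B i → Bool} (hl : PolyTime l)
    (hg : PolyTime (fun i (p : A i × B i) => g i p.1 p.2)) :
    PolyTime (fun i a => (l i a).filter (g i a)) :=
  (flatMap (g := fun i a b => _root_.cond (g i a b) [b] []) hl
    (hg.cond (id.snd.cons nil) nil)).congr fun i a => by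
    induction l i a with
    | nil => rfl
    | cons b m ih => rw [List.flatMap_cons, ih, List.filter_cons]; cases g i a b <;> rfl

theorem any {l : ∀ i, A i → List (B i)} {g : ∀ i, A i → B i → Bool} (hl : PolyTime l)
    (hg : PolyTime (fun i (p : A i × B i) => g i p.1 p.2)) :
    PolyTime (fun i a => (l i a).any (g i a)) :=
  (hl.filter hg).isEmpty.not.congr fun i a => by
    induction l i a with
    | nil => rfl
    | cons b m ih =>
      rw [List.any_cons, ← ih, List.filter_cons]; cases g i a b <;> rfl

theorem all {l : ∀ i, A i → List (B i)} {g : ∀ i, A i → B i → Bool} (hl : PolyTime l)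
    (hg : PolyTime (fun i (p : A i × B i) => g i p.1 p.2)) :
    PolyTime (fun i a => (l i a).all (g i a)) :=
  (any (g := fun i a b => !g i a b) hl hg.not).not.congr fun i a => by
    rw [List.not_any_eq_all_not]; simp

theorem length {l : ∀ i, A i → List (B i)} (hl : PolyTime l) :
    PolyTime (fun i a => (l i a).length) :=
  -- A list of zeros has the same encoding as its length in unary.
  (map (g := fun i a b => 0) hl (natConst 0)).congrVal fun i a => by
    induction l i a with
    | nil => rfl
    | cons b m ih => exact congrArg (Val.cons _) ih

theorem iterate {n : ∀ i, A i → ℕ} {init : ∀ i, A i → S i} {f : ∀ i, A i → S i → S i}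
    (hn : PolyTime n) (hinit : PolyTime init)
    (hf : PolyTime (fun i (p : A i × S i) => f i p.1 p.2))
    (hsz : ∃ k, ∀ i a m, m ≤ n i a → sz ((f i a)^[m] (init i a)) ≤ sz a ^ k) :
    PolyTime (fun i a => (f i a)^[n i a] (init i a)) := by
  obtain ⟨k, hk⟩ := hsz
  -- The unary counter is itself a list of zeros, so iteration is a fold that ignores the entries.
  have hr : PolyTime (fun i a => List.replicate (n i a) 0) := hn.congrVal fun i a => by
    induction n i a with
    | zero => rfl
    | succ n ih => exact congrArg (Val.cons _) ih
  have key : ∀ i a (l : List ℕ), l.foldl (fun s _ => f i a s) (init i a)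
      = (f i a)^[l.length] (init i a) := by
    intro i a l
    induction l using List.reverseRecOn with
    | nil => rfl
    | append_singleton l b ih =>
      rw [List.foldl_append, ih, List.length_append, List.length_singleton,
        Function.iterate_succ_apply']
      rfl
  refine (foldl (step := fun i a s _ => f i a s) hr hinit (hf.comp id.fst)
    ⟨k, fun i a l' hl' => ?_⟩).congr fun i a => ?_
  · rw [key]
    exact hk i a _ (by simpa using hl'.length_le)
  · rw [key, List.length_replicate]

theorem iterate_of_sz_le {n : ∀ i, A i → ℕ} {init : ∀ i, A i → S i} {f : ∀ i, A i → S i → S i}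
    (hn : PolyTime n) (hinit : PolyTime init)
    (hf : PolyTime (fun i (p : A i × S i) => f i p.1 p.2))
    (hsz : ∀ i a s, sz (f i a s) ≤ sz s) :
    PolyTime (fun i a => (f i a)^[n i a] (init i a)) := by
  refine iterate hn hinit hf ?_
  obtain ⟨k, hk⟩ := hinit.size
  refine ⟨k, fun i a m _ => le_trans ?_ (hk i a)⟩
  induction m with
  | zero => exact le_rfl
  | succ m ih => rw [Function.iterate_succ_apply']; exact (hsz _ _ _).trans (ih (by omega))

theorem drop {n : ∀ i, A i → ℕ} {l : ∀ i, A i → List (B i)} (hn : PolyTime n) (hl : PolyTime l) :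
    PolyTime (fun i a => (l i a).drop (n i a)) :=
  (iterate_of_sz_le (f := fun _ _ s => s.tail) hn hl id.snd.tail
    fun _ _ s => (List.tail_sublist s).sz_le).congr fun i a => by
    induction n i a with
    | zero => rfl
    | succ n ih => rw [Function.iterate_succ_apply', ih, List.tail_drop]

theorem getElem? {n : ∀ i, A i → ℕ} {l : ∀ i, A i → List (B i)} (hn : PolyTime n)
    (hl : PolyTime l) : PolyTime (fun i a => (l i a)[n i a]?) :=
  (hn.drop hl).head?.congr fun i a => by rw [List.head?_drop]

theorem sub {m n : ∀ i, A i → ℕ} (hm : PolyTime m) (hn : PolyTime n) :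
    PolyTime (fun i a => m i a - n i a) :=
  (iterate_of_sz_le (f := fun _ _ s => s - 1) hn hm id.snd.pred
    fun _ _ s => by rw [sz_nat, sz_nat]; omega).congr fun i a => by
    induction n i a with
    | zero => rfl
    | succ n ih => rw [Function.iterate_succ_apply', ih]; omega

theorem add {m n : ∀ i, A i → ℕ} (hm : PolyTime m) (hn : PolyTime n) :
    PolyTime (fun i a => m i a + n i a) := by
  have key : ∀ m n : ℕ, (fun s => s + 1)^[n] m = m + n := by
    intro m n
    induction n with
    | zero => rfl
    | succ n ih => rw [Function.iterate_succ_apply', ih]; omega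
  refine (iterate (f := fun _ _ s => s + 1) hn hm id.snd.succ ?_).congr fun i a => key _ _
  obtain ⟨k, hk⟩ := hm.size.add hn.size
  refine ⟨k, fun i a j hj => le_trans ?_ (hk i a)⟩
  rw [key]
  simp only [sz_nat]
  omega

theorem mul {m n : ∀ i, A i → ℕ} (hm : PolyTime m) (hn : PolyTime n) :
    PolyTime (fun i a => m i a * n i a) := by
  have key : ∀ m n : ℕ, (fun s => s + m)^[n] 0 = m * n := by
    intro m n
    induction n with
    | zero => rfl
    | succ n ih => rw [Function.iterate_succ_apply', ih]; rfl
  refine (iterate (f := fun i a s => s + m i a) hn (natConst 0) (id.snd.add (hm.comp id.fst))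
    ?_).congr fun i a => key _ _
  obtain ⟨k, hk⟩ := hm.size.mul hn.size
  refine ⟨k, fun i a j hj => le_trans ?_ (hk i a)⟩
  rw [key]
  simp only [sz_nat]
  have := Nat.mul_le_mul_left (m i a) hj
  nlinarith

theorem decideLe {m n : ∀ i, A i → ℕ} (hm : PolyTime m) (hn : PolyTime n) :
    PolyTime (fun i a => decide (m i a ≤ n i a)) :=
  (hm.sub hn).decideEqZero.congr fun i a => by simp [Nat.sub_eq_zero_iff_le]

theorem decideLt {m n : ∀ i, A i → ℕ} (hm : PolyTime m) (hn : PolyTime n) :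
    PolyTime (fun i a => decide (m i a < n i a)) :=
  hm.succ.decideLe hn

theorem range {n : ∀ i, A i → ℕ} (hn : PolyTime n) : PolyTime (fun i a => List.range (n i a)) := by
  have key : ∀ n : ℕ, (fun s : List ℕ => s ++ [s.length])^[n] [] = List.range n := by
    intro n
    induction n with
    | zero => rfl
    | succ n ih => rw [Function.iterate_succ_apply', ih, List.range_succ, List.length_range]
  refine (iterate (f := fun i a s => s ++ [s.length]) hn nil
    (id.snd.append (id.snd.length.cons nil)) ?_).congr fun i a => key _
  obtain ⟨k, hk⟩ := (PolyBounded.const 2).add (hn.size.mul hn.size)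
  refine ⟨k, fun i a j hj => le_trans ?_ (hk i a)⟩
  rw [key]
  refine (sz_list_le (m := sz (n i a)) fun b hb => ?_).trans ?_
  · have := List.mem_range.1 hb
    simp only [sz_nat]
    omega
  · refine Nat.add_le_add_left (Nat.mul_le_mul_right _ ?_) _
    rw [List.length_range, sz_nat]
    omega

theorem take {n : ∀ i, A i → ℕ} {l : ∀ i, A i → List (B i)} (hn : PolyTime n) (hl : PolyTime l) :
    PolyTime (fun i a => (l i a).take (n i a)) :=
  -- A prefix is a suffix of the reversed list; truncated subtraction covers a count beyond the
  -- length.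
  ((hl.length.sub hn).drop hl.reverse).reverse.congr fun i a => by
    rw [List.drop_reverse, List.reverse_reverse]
    rcases le_total (n i a) (l i a).length with h | h
    · congr 1; omega
    · rw [List.take_of_length_le h, List.take_of_length_le (by omega)]

theorem dropLast {l : ∀ i, A i → List (B i)} (hl : PolyTime l) :
    PolyTime (fun i a => (l i a).dropLast) :=
  (hl.length.pred.take hl).congr fun i a => by rw [List.dropLast_eq_take]

end PolyTime

/-! ## Equality tests -/

theorem sz_vnil : sz Val.nil = 2 := rfl

theorem sz_vcons (a b : Val) : sz (Val.cons a b) = sz a + sz b := rfl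


/-- The encoding of the objects of a type is injective. -/
class InjectiveToVal (α : Type) [ToVal α] : Prop where
  inj : Function.Injective (toVal : α → Val)

theorem toVal_inj {α : Type} [ToVal α] [InjectiveToVal α] {a b : α} : toVal a = toVal b ↔ a = b :=
  InjectiveToVal.inj.eq_iff

theorem natToVal_injective : Function.Injective natToVal := by
  intro m n h
  induction m generalizing n with
  | zero => cases n with
    | zero => rfl
    | succ n => simp [natToVal] at h
  | succ m ih => cases n with
    | zero => simp [natToVal] at h
    | succ n =>
      simp only [natToVal, Val.cons.injEq, true_and] at h
      rw [ih h]

instance : InjectiveToVal ℕ := ⟨natToVal_injective⟩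

instance {n : ℕ} : InjectiveToVal (Fin n) :=
  ⟨fun _ _ h => Fin.ext (natToVal_injective h)⟩

instance {α β : Type} [ToVal α] [ToVal β] [InjectiveToVal α] [InjectiveToVal β] :
    InjectiveToVal (α × β) :=
  ⟨fun a b h => by
    injection h with h1 h2
    exact Prod.ext (toVal_inj.1 h1) (toVal_inj.1 h2)⟩

instance {α : Type} [ToVal α] [InjectiveToVal α] : InjectiveToVal (List α) :=
  ⟨fun l => by
    induction l with
    | nil =>
      intro m h
      cases m with
      | nil => rfl
      | cons b m => cases h
    | cons a l ih =>
      intro m h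
      cases m with
      | nil => cases h
      | cons b m =>
        injection h with h1 h2
        rw [toVal_inj.1 h1, ih h2]⟩

instance {α : Type} [ToVal α] [InjectiveToVal α] : InjectiveToVal (Option α) :=
  ⟨fun a b h => by
    cases a <;> cases b
    · rfl
    · cases h
    · cases h
    · injection h with h1 h2
      rw [toVal_inj.1 h1]⟩

instance {D : Type} [ToVal D] [InjectiveToVal D] : InjectiveToVal (MemOp D) :=
  ⟨fun a b h => by
    cases a <;> cases b <;> injection h with h1 h2
    · rw [toVal_inj.1 h2]
    · cases h1
    · cases h1
    · rw [toVal_inj.1 h2]⟩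

instance {D Q : Type} [ToVal D] [ToVal Q] [InjectiveToVal D] [InjectiveToVal Q] :
    InjectiveToVal (Witness D Q) :=
  ⟨fun ⟨w, q, σ⟩ ⟨w', q', σ'⟩ h => by
    have h' : toVal (w, q, σ) = toVal (w', q', σ') := h
    rw [toVal_inj] at h'
    cases h'
    rfl⟩

instance {D : Type} [DecidableEq D] : DecidableEq (MemOp D)
  | MemOp.wr a, MemOp.wr b => decidable_of_iff (a = b) (by simp)
  | MemOp.rd a, MemOp.rd b => decidable_of_iff (a = b) (by simp)
  | MemOp.wr _, MemOp.rd _ => isFalse (by simp)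
  | MemOp.rd _, MemOp.wr _ => isFalse (by simp)

instance {D Q : Type} [DecidableEq D] [DecidableEq Q] : DecidableEq (Witness D Q) :=
  fun x y => decidable_of_iff (x.word = y.word ∧ x.target = y.target ∧ x.pos = y.pos)
    (by cases x; cases y; simp)

namespace PolyTime

variable {I : Type} {A B C D S Q : I → Type}
variable [∀ i, ToVal (A i)] [∀ i, ToVal (B i)] [∀ i, ToVal (C i)] [∀ i, ToVal (D i)]
variable [∀ i, ToVal (S i)] [∀ i, ToVal (Q i)]

/-- An explicit stack of pairs still to be compared replaces recursion on trees. Splitting a pair of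
cells keeps the total size of the stack and adds an entry; any other case removes an entry, whose
size is at least `4`. Hence size minus number of entries decreases. A mismatch only clears the flag.
-/
theorem decideEqVal {f g : ∀ i, A i → Val} [∀ i a, Decidable (f i a = g i a)] (hf : PolyTime f)
    (hg : PolyTime g) : PolyTime (fun i a => decide (f i a = g i a)) := by
  refine whileLoop (S := fun _ => Bool × List (Val × Val)) (c := fun _ s => !s.2.isEmpty)
    (f := fun _ s => s.2.head?.elim s fun p => _root_.cond (p.1.isCons && p.2.isCons)
      (s.1, (p.1.left, p.2.left) :: (p.1.right, p.2.right) :: s.2.tail)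
      (s.1 && !(p.1.isCons || p.2.isCons), s.2.tail))
    (init := fun i a => (Bool.true, [(f i a, g i a)])) (out := fun i s => s.1)
    (fun i a s => ((s.1 = Bool.true ∧ ∀ p ∈ s.2, p.1 = p.2) ↔ f i a = g i a) ∧
      sz s.2 ≤ sz [(f i a, g i a)])
    (fun i s => sz s.2 - s.2.length) id.snd.isEmpty.not ?_ (true.pair ((hf.pair hg).cons nil))
    id.fst (fun i a => by simp) ?_ ?_ ?_ ?_
  · refine optionElim (g := fun i (s : Bool × List (Val × Val)) (p : Val × Val) =>
      _root_.cond (p.1.isCons && p.2.isCons)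
        (s.1, (p.1.left, p.2.left) :: (p.1.right, p.2.right) :: s.2.tail)
        (s.1 && !(p.1.isCons || p.2.isCons), s.2.tail)) id.snd.head? id ?_
    have h1 : PolyTime (A := fun _ : I => (Bool × List (Val × Val)) × (Val × Val))
      (fun _ p => p.2.1) := id.snd.fst
    have h2 : PolyTime (A := fun _ : I => (Bool × List (Val × Val)) × (Val × Val))
      (fun _ p => p.2.2) := id.snd.snd
    exact (h1.visCons.and h2.visCons).cond
      (id.fst.fst.pair ((h1.vleft.pair h2.vleft).cons ((h1.vright.pair h2.vright).cons
        id.fst.snd.tail)))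
      ((id.fst.fst.and (h1.visCons.or h2.visCons).not).pair id.fst.snd.tail)
  · rintro i a ⟨b, l⟩ ⟨h1, h2⟩ hc
    cases l with
    | nil => simp at hc
    | cons p l =>
      obtain ⟨u, v⟩ := p
      have hl := length_le_sz l
      dsimp only at h1 h2
      rw [← h1]
      simp only [sz_cons, sz_prod] at h2 ⊢
      rcases u with _ | ⟨u, u'⟩ <;> rcases v with _ | ⟨v, v'⟩ <;>
        simp only [Val.isCons, List.head?_cons, Option.elim_some, List.tail_cons, Val.left, Val.right,
          Bool.and_true, Bool.and_false, Bool.or_true, Bool.or_false, Bool.not_true,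
          Bool.not_false, cond_true, cond_false, List.length_cons,
          sz_cons, sz_prod, sz_vnil, sz_vcons, List.forall_mem_cons, Val.cons.injEq,
          reduceCtorEq, true_and, false_and, and_false, iff_self] at h2 hl ⊢
      · omega
      · omega
      · omega
      · refine ⟨⟨by simp only [and_assoc], by omega⟩, ?_⟩
        have := two_le_sz u
        omega
  · rintro i a ⟨b, l⟩ ⟨h1, h2⟩ hc
    cases l with
    | nil => rw [Bool.eq_iff_iff, decide_eq_true_iff, ← h1]; simp
    | cons p l => simp at hc
  · obtain ⟨k, hk⟩ := (PolyBounded.const (A := A) 4).add ((hf.pair hg).cons nil).size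
    refine ⟨k, fun i a s hs => le_trans ?_ (hk i a)⟩
    have := sz_bool_le s.1
    have := hs.2
    obtain ⟨b, l⟩ := s
    rw [sz_prod]
    dsimp only at *
    omega
  · exact ((hf.pair hg).cons nil).size.mono fun i a => Nat.sub_le _ _

theorem decideEq {f g : ∀ i, A i → B i} [∀ i, InjectiveToVal (B i)]
    [∀ i a, Decidable (f i a = g i a)] (hf : PolyTime f) (hg : PolyTime g) :
    PolyTime (fun i a => decide (f i a = g i a)) := by
  classical
  exact (hf.val.decideEqVal hg.val).congr fun i a => by simp only [toVal_inj]

theorem decideMem {f : ∀ i, A i → B i} {l : ∀ i, A i → List (B i)} [∀ i, InjectiveToVal (B i)]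
    [∀ i a, Decidable (f i a ∈ l i a)] (hf : PolyTime f) (hl : PolyTime l) :
    PolyTime (fun i a => decide (f i a ∈ l i a)) := by
  classical
  exact (any (g := fun i a b => decide (f i a = b)) hl ((hf.comp id.fst).decideEq id.snd)).congr
    fun i a => by rw [Bool.eq_iff_iff]; simp

theorem idxOf {f : ∀ i, A i → B i} {l : ∀ i, A i → List (B i)} [∀ i, InjectiveToVal (B i)]
    [∀ i, DecidableEq (B i)] (hf : PolyTime f) (hl : PolyTime l) :
    PolyTime (fun i a => (l i a).idxOf (f i a)) := by
  -- Scanning from the right, each match resets the counter, so the leftmost match determines the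
  -- result; without a match the length remains, in accordance with `List.idxOf`.
  refine (foldl_of_le_add (step := fun i a n b => _root_.cond (decide (b = f i a)) 0 (n + 1))
    hl.reverse (natConst 0) ((id.snd.decideEq (hf.comp id.fst.fst)).cond (natConst 0)
    id.fst.snd.succ) ⟨1, fun i a n b => ?_⟩).congr fun i a => ?_
  · rw [pow_one]
    have := two_le_sz a
    rcases decide (b = f i a) with _ | _
    · rw [cond_false, sz_succ]; omega
    · rw [cond_true, sz_nat, sz_nat]; omega
  · rw [List.foldl_reverse]
    induction l i a with
    | nil => rfl
    | cons b m ih =>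
      rw [List.foldr_cons, ih, List.idxOf_cons]
      by_cases h : b = f i a
      · simp [h]
      · simp [h, beq_eq_false_iff_ne.2 h]

/-! ## Automation -/

theorem witness {w : ∀ i, A i → List (Q i × Option (D i))} {q : ∀ i, A i → Q i}
    {σ : ∀ i, A i → List ℕ} (hw : PolyTime w) (hq : PolyTime q) (hσ : PolyTime σ) :
    PolyTime (fun i a => Witness.mk (w i a) (q i a) (σ i a)) :=
  (hw.pair (hq.pair hσ)).congrVal fun _ _ => rfl

theorem witness_word {x : ∀ i, A i → Witness (D i) (Q i)} (hx : PolyTime x) :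
    PolyTime (fun i a => (x i a).word) :=
  hx.val.vleft.congrVal fun _ _ => rfl

theorem witness_target {x : ∀ i, A i → Witness (D i) (Q i)} (hx : PolyTime x) :
    PolyTime (fun i a => (x i a).target) :=
  hx.val.vright.vleft.congrVal fun _ _ => rfl

theorem witness_pos {x : ∀ i, A i → Witness (D i) (Q i)} (hx : PolyTime x) :
    PolyTime (fun i a => (x i a).pos) :=
  hx.val.vright.vright.congrVal fun _ _ => rfl

theorem memOp_wr {f : ∀ i, A i → D i} (hf : PolyTime f) : PolyTime (fun i a => MemOp.wr (f i a)) :=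
  (vnil.vcons hf.val).congrVal fun _ _ => rfl

/-- Polynomial time, proved by decomposing the function into basic operations. -/
theorem auto {f : ∀ i, A i → B i} (h : PolyTime f := by
    repeat' with_reducible first
      | assumption
      | exact PolyTime.id
      | exact PolyTime.nil
      | exact PolyTime.none
      | exact PolyTime.true
      | exact PolyTime.false
      | exact PolyTime.natConst _
      | apply PolyTime.fst
      | apply PolyTime.snd
      | apply PolyTime.pair
      | apply PolyTime.cons
      | apply PolyTime.some
      | apply PolyTime.cond
      | apply PolyTime.and
      | apply PolyTime.or
      | apply PolyTime.not
      | apply PolyTime.optionElim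
      | apply PolyTime.optionMap
      | apply PolyTime.isSome
      | apply PolyTime.isEmpty
      | apply PolyTime.head?
      | apply PolyTime.tail
      | apply PolyTime.reverse
      | apply PolyTime.append
      | apply PolyTime.flatMap
      | apply PolyTime.map
      | apply PolyTime.filter
      | apply PolyTime.any
      | apply PolyTime.all
      | apply PolyTime.length
      | apply PolyTime.drop
      | apply PolyTime.take
      | apply PolyTime.dropLast
      | apply PolyTime.getElem?
      | apply PolyTime.range
      | apply PolyTime.idxOf
      | apply PolyTime.sub
      | apply PolyTime.add
      | apply PolyTime.decideLe
      | apply PolyTime.decideLt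
      | apply PolyTime.decideEq
      | apply PolyTime.decideMem
      | apply PolyTime.witness
      | apply PolyTime.witness_word
      | apply PolyTime.witness_target
      | apply PolyTime.witness_pos
      | apply PolyTime.memOp_wr) : PolyTime f := h

end PolyTime

/-! ## The algorithm -/

section Algorithm

variable {D Q QL QC : Type} [DecidableEq D] [DecidableEq Q] [DecidableEq QL] [DecidableEq QC]

/-- The value read by a transition label. -/
def readValue : Option (MemOp D) → Option D
  | some (MemOp.rd b) => some b
  | _ => none

/-- The value written by a transition label. -/
def writtenValue : Option (MemOp D) → Option D
  | some (MemOp.wr b) => some b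
  | _ => none

/-- The end points of the paths that start in `P` and follow the edges in `E`. -/
def reachable (E : List (Q × Q)) (P : List Q) : List Q :=
  (fun R => P ++ (E.filter fun e => decide (e.1 ∈ R)).map fun e => e.2)^[E.length] P

/-- The states that a thread reaches from `P` while reading only values from `Γ`. -/
def reach (T : List (Q × Option (MemOp D) × Q)) (Γ : List D) (P : List Q) : List Q :=
  reachable ((T.filter fun t => (readValue t.2.1).elim true fun b => decide (b ∈ Γ)).map
    fun t => (t.1, t.2.2)) P

/-- A list of the elements of `Loop(q, Γ)`. -/
def loopList (T : List (QL × Option (MemOp D) × QL)) (q : QL) (Γ : List D) : List D :=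
  T.flatMap fun t => (writtenValue t.2.1).elim [] fun b =>
    cond (decide (t.1 ∈ reach T Γ [q]) && decide (q ∈ reach T Γ [t.2.2])) [b] []

/-- A list of the elements of `S_α(i)`. -/
def availList (x : Witness D Q) (α : List D) (i : ℕ) : List D :=
  (List.range α.length).flatMap fun l => α[l]?.elim [] fun b =>
    x.pos[l]?.elim [] fun p => cond (decide (p ≤ i)) [b] []

/-- A list of the elements of `Γ_i`. -/
def gammaList (T : List (QL × Option (MemOp D) × QL)) (x : Witness D QL) (α : List D) (i : ℕ) :
    List D :=
  (x.word[i - 1]?.elim [] fun l => loopList T l.1 (availList x α i)) ++ availList x α i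

/-- The states that a thread reaches from `P` while reading `a` or nothing. -/
def readStep (T : List (Q × Option (MemOp D) × Q)) (a : Option D) (P : List Q) : List Q :=
  reach T [] (reach T [] P ++ a.elim [] fun b => (T.filter fun t =>
    decide (readValue t.2.1 = some b) && decide (t.1 ∈ reach T [] P)).map fun t => t.2.2)

/-- The states that the contributor reaches from `P` while reading a word of
`Γ_1^* {a_1, ε} … Γ_n^* {a_n, ε}`. -/
def exprStates (TL : List (QL × Option (MemOp D) × QL)) (TC : List (QC × Option (MemOp D) × QC))
    (x : Witness D QL) (α : List D) (P : List QC) (n : ℕ) : List QC :=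
  (List.range n).foldl (fun R i => readStep TC (x.word[i]?.elim none fun l => l.2)
    (reach TC (gammaList TL x α (i + 1)) R)) P

/-- The test of `LValid`. -/
def lValidTest (T : List (QL × Option (MemOp D) × QL)) (β : List D) (x : Witness D QL) : Bool :=
  decide (β.length = x.pos.length) &&
  (List.range x.word.length).all fun m => x.word[m]?.elim true fun l =>
    ((x.word.map fun l => l.1) ++ [x.target])[m + 1]?.elim true fun q' =>
      l.2.elim (decide (l.1 = q') || (decide ((l.1, none, q') ∈ T) ||
          T.any fun t => decide (t.1 = l.1) && decide (t.2.2 = q') &&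
            (readValue t.2.1).elim false fun b => decide (b ∈ availList x β (m + 1))))
        fun b => decide ((l.1, some (MemOp.wr b), q') ∈ T)

/-- The test of `CValid` for the last element of `β`. -/
def cValidTest (TL : List (QL × Option (MemOp D) × QL)) (q : QC)
    (TC : List (QC × Option (MemOp D) × QC)) (β : List D) (x : Witness D QL) : Bool :=
  decide (β.length = x.pos.length) &&
  x.pos[β.dropLast.length]?.elim false fun j => β[β.length - 1]?.elim false fun b =>
    TC.any fun t => decide (writtenValue t.2.1 = some b) &&
      decide (t.1 ∈ reach TC (gammaList TL x β.dropLast j)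
        (exprStates TL TC x β.dropLast [q] (j - 1)))

/-- One step of the computation of the valid pairs: those pairs among `cand` whose sequence is
empty or that extend a pair of `V`. -/
def validStep (TL : List (QL × Option (MemOp D) × QL)) (q : QC)
    (TC : List (QC × Option (MemOp D) × QC)) (W : List (Witness D QL))
    (cand : List (List D × Witness D QL)) (V : List (List D × Witness D QL)) :
    List (List D × Witness D QL) :=
  cand.filter fun p => cond p.1.isEmpty (lValidTest TL p.1 p.2)
    (W.any fun x => W.any fun y => decide (y.pos.length = 1) &&
      (y.word.head?.elim false fun l => decide (l.1 = x.target)) &&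
      decide (p.2 = x.shortConcat y) && lValidTest TL p.1 (x.concat y) &&
      cValidTest TL q TC p.1 (x.concat y) && decide ((p.1.dropLast, x) ∈ V))

/-- The lists of length at most `n` over `A`. -/
def allLists {α : Type} (A : List α) (n : ℕ) : List (List α) :=
  (fun R => [] :: A.flatMap fun a => R.map fun l => a :: l)^[n] [[]]

/-- The test whether a list of numbers is increasing with values in `[1..n]`. -/
def isPosList (n : ℕ) (l : List ℕ) : Bool :=
  (l.all fun p => decide (1 ≤ p) && decide (p ≤ n)) &&
  (l.foldl (fun s p => (s.1 && decide (s.2 ≤ p), p)) (true, 0)).1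

/-- The short witnesses over the states `Ls` and the values `Ds`. -/
def shortWitnesses (Ds : List D) (Ls : List Q) : List (Witness D Q) :=
  (((((allLists (Ls.product (none :: Ds.map fun d => some d)) Ls.length).filter fun w =>
    !(Witness.firstRepetition (w.map fun l => l.1)).isSome).product
    (Ls.product (allLists (List.range (Ls.length + 1)) Ds.length))).filter fun t =>
      isPosList t.1.length t.2.2).map fun t => ⟨t.1, t.2.1, t.2.2⟩)

/-- The pairs of a first-write sequence over `Ds` and a witness of `W` of the same order. -/
def candidates (Ds : List D) (W : List (Witness D Q)) : List (List D × Witness D Q) :=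
  (((allLists Ds Ds.length).filter fun β => !(Witness.firstRepetition β).isSome).product W).filter
    fun p => decide (p.2.pos.length = p.1.length)

/-- The list of all valid pairs. -/
def validList (Ds : List D) (Ls : List QL) (TL : List (QL × Option (MemOp D) × QL)) (q : QC)
    (TC : List (QC × Option (MemOp D) × QC)) : List (List D × Witness D QL) :=
  (validStep TL q TC (shortWitnesses Ds Ls) (candidates Ds (shortWitnesses Ds Ls)))^[Ds.length + 1]
    []

end Algorithm


/-! ## The size of the intermediate results -/

theorem sz_map_le {α β : Type} [ToVal α] [ToVal β] {f : α → β} {l : List α}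
    (h : ∀ a ∈ l, sz (f a) ≤ sz a) : sz (l.map f) ≤ sz l := by
  induction l with
  | nil => exact le_rfl
  | cons a l ih =>
    simp only [List.map_cons, sz_cons]
    exact add_le_add (h a List.mem_cons_self) (ih fun b hb => h b (List.mem_cons_of_mem _ hb))

theorem sz_append_le {α : Type} [ToVal α] (l m : List α) : sz (l ++ m) ≤ sz l + sz m :=
  Nat.le_of_add_right_le (sz_append l m).le

section

variable {D Q : Type} [DecidableEq D] [DecidableEq Q] [ToVal D] [ToVal Q]

/-- Every round rebuilds the list from `P` and targets of edges in `E` instead of appending to the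
previous list, so repetitions do not accumulate and the bound is uniform in `m`. -/
theorem sz_iterate_reachable_le (E : List (Q × Q)) (P : List Q) (m : ℕ) :
    sz ((fun R => P ++ (E.filter fun e => decide (e.1 ∈ R)).map fun e => e.2)^[m] P)
      ≤ sz P + sz E := by
  cases m with
  | zero => exact Nat.le_add_right _ _
  | succ m =>
    rw [Function.iterate_succ_apply']
    exact (sz_append_le _ _).trans (Nat.add_le_add_left
      ((sz_map_le fun e _ => Nat.le_add_left _ _).trans List.filter_sublist.sz_le) _)

theorem sz_reach_le (T : List (Q × Option (MemOp D) × Q)) (Γ : List D) (P : List Q) :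
    sz (reach T Γ P) ≤ sz P + sz T := by
  refine (sz_iterate_reachable_le _ _ _).trans (Nat.add_le_add_left
    ((sz_map_le fun e _ => ?_).trans List.filter_sublist.sz_le) _)
  simp only [sz_prod]
  exact Nat.add_le_add_left (Nat.le_add_left _ _) _

/-- The coefficient `1` of `sz P` matters: it makes the growth additive when such steps are chained
along the word of a witness. -/
theorem sz_readStep_le (T : List (Q × Option (MemOp D) × Q)) (a : Option D) (P : List Q) :
    sz (readStep T a P) ≤ sz P + 3 * sz T := by
  have h : sz (a.elim [] fun b => (T.filter fun t =>
      decide (readValue t.2.1 = some b) && decide (t.1 ∈ reach T [] P)).map fun t => t.2.2)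
      ≤ sz T := by
    cases a with
    | none => exact two_le_sz _
    | some b =>
      refine (sz_map_le fun e _ => ?_).trans List.filter_sublist.sz_le
      exact (Nat.le_add_left _ _).trans (Nat.le_add_left _ _)
  have h1 := sz_reach_le T [] P
  have h2 := sz_append_le (reach T [] P) (a.elim [] fun b => (T.filter fun t =>
      decide (readValue t.2.1 = some b) && decide (t.1 ∈ reach T [] P)).map fun t => t.2.2)
  refine (sz_reach_le _ _ _).trans ?_
  omega

/-- Letters are only deleted and positions, encoded in unary, never increase; the iteration in
`shrinkStar` therefore needs no further size estimate. -/
theorem sz_shrink_le (x : Witness D Q) : sz x.shrink ≤ sz x := by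
  unfold Witness.shrink
  split
  · exact le_rfl
  · rename_i i j h
    have hij := Witness.firstRepetition_lt _ _ _ h
    refine add_le_add ?_ (Nat.add_le_add_left ?_ _)
    · refine List.Sublist.sz_le ?_
      conv_rhs => rw [← List.take_append_drop i x.word]
      exact (List.Sublist.refl _).append (List.drop_sublist_drop_left _ hij.1.le)
    · refine sz_map_le fun s _ => ?_
      simp only [sz_nat]
      split_ifs <;> omega

/-- The number of lists satisfies `1 + |A| * (|A| + 1) ^ n ≤ (|A| + 1) ^ (n + 1)`. Within the main
computation, this is the only source of exponential size. -/
theorem sz_allLists_le {α : Type} [ToVal α] (A : List α) (n : ℕ) :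
    sz (allLists A n) ≤ 2 + (A.length + 1) ^ n * (2 + n * sz A) := by
  have key : (allLists A n).length ≤ (A.length + 1) ^ n ∧
      ∀ l ∈ allLists A n, sz l ≤ 2 + n * sz A := by
    unfold allLists
    induction n with
    | zero => simp [sz_nil]
    | succ n ih =>
      rw [Function.iterate_succ_apply']
      constructor
      · have := Nat.mul_le_mul_left A.length ih.1
        have := Nat.one_le_pow n (A.length + 1) (by omega)
        simp only [List.length_cons, List.length_flatMap, List.length_map, List.map_const',
          List.sum_replicate, smul_eq_mul, pow_succ, Nat.mul_add]
        rw [Nat.mul_comm _ A.length]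
        omega
      · intro l hl
        simp only [List.mem_cons, List.mem_flatMap, List.mem_map] at hl
        rcases hl with rfl | ⟨a, ha, m, hm, rfl⟩
        · exact Nat.le_add_right _ _
        · have := ih.2 m hm
          have := sz_le_of_mem ha
          rw [sz_cons, Nat.add_mul]
          omega
  exact (sz_list_le key.2).trans (Nat.add_le_add_left (Nat.mul_le_mul_right _ key.1) _)

end

/-! ## The algorithm takes polynomial time after padding -/

namespace PolyTime

variable {I : Type} {A B D Q L C : I → Type}
variable [∀ i, ToVal (A i)] [∀ i, ToVal (B i)] [∀ i, ToVal (D i)]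
variable [∀ i, ToVal (Q i)] [∀ i, ToVal (L i)] [∀ i, ToVal (C i)]

theorem readValue {o : ∀ i, A i → Option (MemOp (D i))} (ho : PolyTime o) :
    PolyTime (fun i a => readValue (o i a)) :=
  -- Only the tag of a read is a cell; `none` and writes both give `nil` here.
  (ho.val.vleft.vleft.visCons.cond (ho.val.vleft.vright.vcons vnil) vnil).congrVal fun i a => by
    rcases o i a with _ | _ | _ <;> rfl

theorem writtenValue {o : ∀ i, A i → Option (MemOp (D i))} (ho : PolyTime o) :
    PolyTime (fun i a => writtenValue (o i a)) :=
  -- The additional outer test separates `none` from a write, whose tag is `nil` as well.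
  (ho.val.visCons.cond (ho.val.vleft.vleft.visCons.cond vnil
    (ho.val.vleft.vright.vcons vnil)) vnil).congrVal fun i a => by
    rcases o i a with _ | _ | _ <;> rfl

theorem availList {x : ∀ i, A i → Witness (D i) (Q i)} {α : ∀ i, A i → List (D i)}
    {n : ∀ i, A i → ℕ} (hx : PolyTime x) (hα : PolyTime α) (hn : PolyTime n) :
    PolyTime (fun i a => availList (x i a) (α i a) (n i a)) := by
  -- With the arguments bundled into one tuple, every subterm becomes a projection of the store,
  -- also below binders, and `auto` can decompose the body.
  refine comp (g := fun i (p : Witness (D i) (Q i) × List (D i) × ℕ) =>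
    _root_.availList p.1 p.2.1 p.2.2) ?_ (hx.pair (hα.pair hn))
  unfold _root_.availList
  exact auto

variable [∀ i, InjectiveToVal (B i)] [∀ i, InjectiveToVal (D i)] [∀ i, InjectiveToVal (Q i)]
variable [∀ i, InjectiveToVal (L i)] [∀ i, InjectiveToVal (C i)]
variable [∀ i, DecidableEq (B i)] [∀ i, DecidableEq (D i)] [∀ i, DecidableEq (Q i)]
variable [∀ i, DecidableEq (L i)] [∀ i, DecidableEq (C i)]

theorem reachable {E : ∀ i, A i → List (Q i × Q i)} {P : ∀ i, A i → List (Q i)} (hE : PolyTime E)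
    (hP : PolyTime P) : PolyTime (fun i a => reachable (E i a) (P i a)) := by
  refine iterate (f := fun i a R => P i a ++ ((E i a).filter fun e => decide (e.1 ∈ R)).map
    fun e => e.2) hE.length hP ?_ ?_
  · have hP' : PolyTime (A := fun i => A i × List (Q i)) (fun i p => P i p.1) := hP.comp id.fst
    have hE' : PolyTime (A := fun i => A i × List (Q i)) (fun i p => E i p.1) := hE.comp id.fst
    exact auto
  · obtain ⟨k, hk⟩ := hP.size.add hE.size
    exact ⟨k, fun i a m _ => (sz_iterate_reachable_le _ _ _).trans (hk i a)⟩

theorem reach {T : ∀ i, A i → List (Q i × Option (MemOp (D i)) × Q i)} {Γ : ∀ i, A i → List (D i)}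
    {P : ∀ i, A i → List (Q i)} (hT : PolyTime T) (hΓ : PolyTime Γ) (hP : PolyTime P) :
    PolyTime (fun i a => reach (T i a) (Γ i a) (P i a)) := by
  refine reachable (map (filter hT (optionElim (readValue ?_) true ?_)) ?_) hP
  · exact auto
  · have hΓ' : PolyTime (A := fun i => (A i × (Q i × Option (MemOp (D i)) × Q i)) × D i)
      (fun i p => Γ i p.1.1) := hΓ.comp id.fst.fst
    exact auto
  · exact auto

theorem loopList {T : ∀ i, A i → List (L i × Option (MemOp (D i)) × L i)} {q : ∀ i, A i → L i}
    {Γ : ∀ i, A i → List (D i)} (hT : PolyTime T) (hq : PolyTime q) (hΓ : PolyTime Γ) :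
    PolyTime (fun i a => loopList (T i a) (q i a) (Γ i a)) := by
  refine comp (g := fun i (p : List (L i × Option (MemOp (D i)) × L i) × L i × List (D i)) =>
    _root_.loopList p.1 p.2.1 p.2.2) ?_ (hT.pair (hq.pair hΓ))
  unfold _root_.loopList
  refine flatMap auto (optionElim (writtenValue auto) nil (cond (and (decideMem auto
    (reach auto auto auto)) (decideMem auto (reach auto auto auto))) auto auto))

theorem gammaList {T : ∀ i, A i → List (L i × Option (MemOp (D i)) × L i)}
    {x : ∀ i, A i → Witness (D i) (L i)} {α : ∀ i, A i → List (D i)} {n : ∀ i, A i → ℕ}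
    (hT : PolyTime T) (hx : PolyTime x) (hα : PolyTime α) (hn : PolyTime n) :
    PolyTime (fun i a => gammaList (T i a) (x i a) (α i a) (n i a)) := by
  refine comp (g := fun i (p : List (L i × Option (MemOp (D i)) × L i) ×
    Witness (D i) (L i) × List (D i) × ℕ) => _root_.gammaList p.1 p.2.1 p.2.2.1 p.2.2.2) ?_
    (hT.pair (hx.pair (hα.pair hn)))
  unfold _root_.gammaList
  exact append (optionElim auto auto (loopList auto auto (availList auto auto auto)))
    (availList auto auto auto)

theorem readStep {T : ∀ i, A i → List (Q i × Option (MemOp (D i)) × Q i)}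
    {o : ∀ i, A i → Option (D i)} {P : ∀ i, A i → List (Q i)} (hT : PolyTime T) (ho : PolyTime o)
    (hP : PolyTime P) : PolyTime (fun i a => readStep (T i a) (o i a) (P i a)) := by
  refine comp (g := fun i (p : List (Q i × Option (MemOp (D i)) × Q i) × Option (D i) ×
    List (Q i)) => _root_.readStep p.1 p.2.1 p.2.2) ?_ (hT.pair (ho.pair hP))
  unfold _root_.readStep
  exact reach auto auto (append (reach auto auto auto) (optionElim auto auto (map (filter auto
    (and (decideEq (readValue auto) auto) (decideMem auto (reach auto auto auto)))) auto)))

theorem exprStates {TL : ∀ i, A i → List (L i × Option (MemOp (D i)) × L i)}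
    {TC : ∀ i, A i → List (C i × Option (MemOp (D i)) × C i)}
    {x : ∀ i, A i → Witness (D i) (L i)} {α : ∀ i, A i → List (D i)} {P : ∀ i, A i → List (C i)}
    {n : ∀ i, A i → ℕ} (hTL : PolyTime TL) (hTC : PolyTime TC) (hx : PolyTime x)
    (hα : PolyTime α) (hP : PolyTime P) (hn : PolyTime n) :
    PolyTime (fun i a => exprStates (TL i a) (TC i a) (x i a) (α i a) (P i a) (n i a)) := by
  suffices h : PolyTime (fun i (p : List (L i × Option (MemOp (D i)) × L i) ×
    List (C i × Option (MemOp (D i)) × C i) × Witness (D i) (L i) × List (D i) × List (C i) × ℕ) =>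
    _root_.exprStates p.1 p.2.1 p.2.2.1 p.2.2.2.1 p.2.2.2.2.1 p.2.2.2.2.2) from
    (h.comp (hTL.pair (hTC.pair (hx.pair (hα.pair (hP.pair hn))))) :)
  unfold _root_.exprStates
  refine foldl_of_le_add auto auto (readStep auto auto (reach auto (gammaList auto auto auto auto)
    auto)) ⟨2, fun i a s b => ?_⟩
  have h1 := sz_readStep_le a.2.1 (a.2.2.1.word[b]?.elim Option.none fun l => l.2)
    (_root_.reach a.2.1 (_root_.gammaList a.1 a.2.2.1 a.2.2.2.1 (b + 1)) s)
  have h2 := sz_reach_le a.2.1 (_root_.gammaList a.1 a.2.2.1 a.2.2.2.1 (b + 1)) s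
  have h3 : sz a.2.1 + 2 ≤ sz a := by
    obtain ⟨u, v, w⟩ := a
    have := two_le_sz u
    have := two_le_sz w
    simp only [sz_prod]
    omega
  have h4 := two_le_sz b
  -- One pass adds at most four times the size of the contributor's transition list; since `sz a +
  -- sz b ≥ 4`, the exponent `2` absorbs the factor.
  have h5 : 4 * (sz a + sz b) ≤ (sz a + sz b) ^ 2 := by
    rw [pow_two]
    exact Nat.mul_le_mul_right _ (by have := two_le_sz a; omega)
  omega

/-- The recursion consults the tail as well as the result for the tail, so a right fold carries
both. It is run as a left fold over the reversed list; its size stays small because both indices are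
below the length. -/
theorem firstRepetition {l : ∀ i, A i → List (Q i)} (hl : PolyTime l) :
    PolyTime (fun i a => Witness.firstRepetition (l i a)) := by
  have key : ∀ i (l : List (Q i)), l.foldr (fun q s =>
      (q :: s.1, _root_.cond (decide (q ∈ s.1)) (Option.some (0, s.1.idxOf q + 1))
        (s.2.map fun ij => (ij.1 + 1, ij.2 + 1)))) ([], Option.none)
      = (l, Witness.firstRepetition l) := by
    intro i l
    induction l with
    | nil => rfl
    | cons q l ih =>
      rw [List.foldr_cons, ih, Witness.firstRepetition]
      by_cases h : q ∈ l <;> simp [h]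
  refine (snd (foldl (S := fun i => List (Q i) × Option (ℕ × ℕ)) (step := fun i a s q =>
    (q :: s.1, _root_.cond (decide (q ∈ s.1)) (Option.some (0, s.1.idxOf q + 1))
        (s.2.map fun ij => (ij.1 + 1, ij.2 + 1)))) hl.reverse (nil.pair none) auto ?_)).congr
    fun i a => ?_
  · obtain ⟨k, hk⟩ := hl.size.add ((PolyBounded.const 3).mul hl.size)
    refine ⟨k, fun i a l' hl' => le_trans ?_ (hk i a)⟩
    rw [List.foldl_eq_foldr_reverse, key]
    have h1 : sz l'.reverse ≤ sz (l i a) :=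
      (List.reverse_sublist.1 (by simpa using hl'.sublist)).sz_le
    refine add_le_add h1 (le_trans ?_ (Nat.mul_le_mul_left 3 h1))
    have h2 := length_le_sz l'.reverse
    rcases h : Witness.firstRepetition l'.reverse with _ | ⟨m, n⟩
    · change 2 ≤ _
      omega
    · have := Witness.firstRepetition_lt _ _ _ h
      change sz m + sz n + 2 ≤ _
      simp only [sz_nat]
      omega
  · rw [List.foldl_reverse, key]

theorem shrink {x : ∀ i, A i → Witness (D i) (Q i)} (hx : PolyTime x) :
    PolyTime (fun i a => (x i a).shrink) := by
  refine comp (g := fun i (x : Witness (D i) (Q i)) => x.shrink) ?_ hx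
  have h : PolyTime (fun i (x : Witness (D i) (Q i)) =>
      (Witness.firstRepetition (x.word.map fun l => l.1)).elim x fun ij => Witness.mk
        (x.word.take ij.1 ++ x.word.drop ij.2) x.target
        (x.pos.map fun s => _root_.cond (decide (s < ij.1 + 1)) s
          (_root_.cond (decide (s ≤ ij.2 + 1)) (ij.1 + 1) (s - (ij.2 - ij.1))))) := by
    refine optionElim (firstRepetition auto) auto ?_
    exact auto
  refine h.congr fun i x => ?_
  unfold Witness.shrink
  rcases Witness.firstRepetition (x.word.map Prod.fst) with _ | ⟨m, n⟩
  · rfl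
  · simp [Bool.cond_decide]

theorem concat {x y : ∀ i, A i → Witness (D i) (Q i)} (hx : PolyTime x) (hy : PolyTime y) :
    PolyTime (fun i a => (x i a).concat (y i a)) := by
  refine comp (g := fun i (p : Witness (D i) (Q i) × Witness (D i) (Q i)) => p.1.concat p.2) ?_
    (hx.pair hy)
  unfold Witness.concat
  exact auto

theorem shortConcat {x y : ∀ i, A i → Witness (D i) (Q i)} (hx : PolyTime x) (hy : PolyTime y) :
    PolyTime (fun i a => (x i a).shortConcat (y i a)) := by
  have h : PolyTime (fun i (x : Witness (D i) (Q i)) => Witness.shrink^[x.word.length] x) :=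
    iterate_of_sz_le (f := fun i _ (s : Witness (D i) (Q i)) => s.shrink) id.witness_word.length id
      (shrink id.snd) fun i _ s => sz_shrink_le s
  exact h.comp (hx.concat hy)

theorem lValidTest {T : ∀ i, A i → List (L i × Option (MemOp (D i)) × L i)}
    {β : ∀ i, A i → List (D i)} {x : ∀ i, A i → Witness (D i) (L i)} (hT : PolyTime T)
    (hβ : PolyTime β) (hx : PolyTime x) :
    PolyTime (fun i a => lValidTest (T i a) (β i a) (x i a)) := by
  suffices h : PolyTime (fun i (p : List (L i × Option (MemOp (D i)) × L i) × List (D i) ×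
      Witness (D i) (L i)) => _root_.lValidTest p.1 p.2.1 p.2.2) from
    (h.comp (hT.pair (hβ.pair hx)) :)
  unfold _root_.lValidTest
  exact and auto (all auto (optionElim auto auto (optionElim auto auto (optionElim auto
    (or auto (or auto (any auto (and auto (optionElim (readValue auto) auto (decideMem auto
      (availList auto auto auto))))))) auto))))

theorem cValidTest {TL : ∀ i, A i → List (L i × Option (MemOp (D i)) × L i)} {q : ∀ i, A i → C i}
    {TC : ∀ i, A i → List (C i × Option (MemOp (D i)) × C i)} {β : ∀ i, A i → List (D i)}
    {x : ∀ i, A i → Witness (D i) (L i)} (hTL : PolyTime TL) (hq : PolyTime q) (hTC : PolyTime TC)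
    (hβ : PolyTime β) (hx : PolyTime x) :
    PolyTime (fun i a => cValidTest (TL i a) (q i a) (TC i a) (β i a) (x i a)) := by
  suffices h : PolyTime (fun i (p : List (L i × Option (MemOp (D i)) × L i) × C i ×
      List (C i × Option (MemOp (D i)) × C i) × List (D i) × Witness (D i) (L i)) =>
      _root_.cValidTest p.1 p.2.1 p.2.2.1 p.2.2.2.1 p.2.2.2.2) from
    (h.comp (hTL.pair (hq.pair (hTC.pair (hβ.pair hx)))) :)
  unfold _root_.cValidTest
  exact and auto (optionElim auto auto (optionElim auto auto (any auto (and
    (decideEq (writtenValue auto) auto) (decideMem auto (reach auto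
      (gammaList auto auto auto auto) (exprStates auto auto auto auto auto auto)))))))

theorem validStep {TL : ∀ i, A i → List (L i × Option (MemOp (D i)) × L i)} {q : ∀ i, A i → C i}
    {TC : ∀ i, A i → List (C i × Option (MemOp (D i)) × C i)}
    {W : ∀ i, A i → List (Witness (D i) (L i))}
    {cand V : ∀ i, A i → List (List (D i) × Witness (D i) (L i))} (hTL : PolyTime TL)
    (hq : PolyTime q) (hTC : PolyTime TC) (hW : PolyTime W) (hc : PolyTime cand)
    (hV : PolyTime V) :
    PolyTime (fun i a => validStep (TL i a) (q i a) (TC i a) (W i a) (cand i a) (V i a)) := by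
  suffices h : PolyTime (fun i (p : List (L i × Option (MemOp (D i)) × L i) × C i ×
      List (C i × Option (MemOp (D i)) × C i) × List (Witness (D i) (L i)) ×
      List (List (D i) × Witness (D i) (L i)) × List (List (D i) × Witness (D i) (L i))) =>
      _root_.validStep p.1 p.2.1 p.2.2.1 p.2.2.2.1 p.2.2.2.2.1 p.2.2.2.2.2) from
    (h.comp (hTL.pair (hq.pair (hTC.pair (hW.pair (hc.pair hV))))) :)
  unfold _root_.validStep
  exact filter auto (cond auto (lValidTest auto auto auto) (any auto (any auto (and (and (and (and
    auto (decideEq auto (shortConcat auto auto))) (lValidTest auto auto (concat auto auto)))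
    (cValidTest auto auto auto auto (concat auto auto))) auto))))

/-- The number of lists is assumed to be polynomial in the argument. This assumption is met only
through padding, and it is passed on up to `polyTime_validList`. -/
theorem allLists {l : ∀ i, A i → List (B i)} {n : ∀ i, A i → ℕ} (hl : PolyTime l)
    (hn : PolyTime n) (h : PolyBounded (fun i a => ((l i a).length + 1) ^ n i a)) :
    PolyTime (fun i a => allLists (l i a) (n i a)) := by
  refine iterate (f := fun i a R => [] :: (l i a).flatMap fun b => R.map fun m => b :: m) hn
    (nil.cons nil) ?_ ?_
  · have hl' : PolyTime (A := fun i => A i × List (List (B i))) (fun i p => l i p.1) :=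
      hl.comp id.fst
    exact auto
  · obtain ⟨k, hk⟩ := (PolyBounded.const 2).add (h.mul ((PolyBounded.const 2).add
      (hn.size.mul hl.size)))
    refine ⟨k, fun i a m hm => (sz_allLists_le (l i a) m).trans (le_trans ?_ (hk i a))⟩
    refine Nat.add_le_add_left (Nat.mul_le_mul (Nat.pow_le_pow_right (Nat.succ_pos _) hm)
      (Nat.add_le_add_left (Nat.mul_le_mul_right _ ?_) _)) _
    rw [sz_nat]
    omega

theorem isPosList {n : ∀ i, A i → ℕ} {l : ∀ i, A i → List ℕ} (hn : PolyTime n)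
    (hl : PolyTime l) : PolyTime (fun i a => isPosList (n i a) (l i a)) := by
  suffices h : PolyTime (fun (_ : I) (p : ℕ × List ℕ) => _root_.isPosList p.1 p.2) from
    (h.comp (hn.pair hl) :)
  unfold _root_.isPosList
  refine and auto (fst (foldl_of_le_add auto auto auto ⟨1, fun i a s p => ?_⟩))
  have := sz_bool_le (s.1 && decide (s.2 ≤ p))
  have := two_le_sz s
  have := two_le_sz a
  rw [sz_prod, pow_one]
  omega

theorem product {l : ∀ i, A i → List (B i)} {m : ∀ i, A i → List (Q i)} (hl : PolyTime l)
    (hm : PolyTime m) : PolyTime (fun i a => (l i a).product (m i a)) := by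
  suffices h : PolyTime (fun i (p : List (B i) × List (Q i)) => p.1.product p.2) from
    (h.comp (hl.pair hm) :)
  unfold List.product
  exact auto

theorem shortWitnesses {Ds : ∀ i, A i → List (D i)} {Ls : ∀ i, A i → List (Q i)}
    (hD : PolyTime Ds) (hL : PolyTime Ls)
    (h1 : PolyBounded (fun i a =>
      (((Ls i a).product (Option.none :: (Ds i a).map Option.some)).length + 1) ^ (Ls i a).length))
    (h2 : PolyBounded (fun i a =>
      ((List.range ((Ls i a).length + 1)).length + 1) ^ (Ds i a).length)) :
    PolyTime (fun i a => shortWitnesses (Ds i a) (Ls i a)) := by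
  unfold _root_.shortWitnesses
  have h3 := allLists (hL.product (auto : PolyTime fun i a =>
    Option.none :: (Ds i a).map Option.some)) hL.length h1
  have h4 := allLists (auto : PolyTime fun i a => List.range ((Ls i a).length + 1)) hD.length h2
  refine map (filter (product (filter h3 ?_) (hL.product h4)) ?_) ?_
  · exact not (isSome (firstRepetition auto))
  · exact isPosList auto auto
  · exact auto

theorem candidates {Ds : ∀ i, A i → List (D i)} {W : ∀ i, A i → List (Witness (D i) (Q i))}
    (hD : PolyTime Ds) (hW : PolyTime W)
    (h : PolyBounded (fun i a => ((Ds i a).length + 1) ^ (Ds i a).length)) :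
    PolyTime (fun i a => candidates (Ds i a) (W i a)) := by
  unfold _root_.candidates
  refine filter (product (filter (allLists hD hD.length h) ?_) hW) ?_
  · exact not (isSome (firstRepetition auto))
  · exact auto

theorem validList {Ds : ∀ i, A i → List (D i)} {Ls : ∀ i, A i → List (L i)}
    {TL : ∀ i, A i → List (L i × Option (MemOp (D i)) × L i)} {q : ∀ i, A i → C i}
    {TC : ∀ i, A i → List (C i × Option (MemOp (D i)) × C i)}
    (hD : PolyTime Ds) (hL : PolyTime Ls) (hTL : PolyTime TL) (hq : PolyTime q)
    (hTC : PolyTime TC)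
    (h1 : PolyBounded (fun i a =>
      (((Ls i a).product (Option.none :: (Ds i a).map Option.some)).length + 1) ^ (Ls i a).length))
    (h2 : PolyBounded (fun i a =>
      ((List.range ((Ls i a).length + 1)).length + 1) ^ (Ds i a).length))
    (h3 : PolyBounded (fun i a => ((Ds i a).length + 1) ^ (Ds i a).length)) :
    PolyTime (fun i a => validList (Ds i a) (Ls i a) (TL i a) (q i a) (TC i a)) := by
  have hW := shortWitnesses hD hL h1 h2
  have hc := candidates hD hW h3
  refine iterate (f := fun i a => _root_.validStep (TL i a) (q i a) (TC i a)
    (_root_.shortWitnesses (Ds i a) (Ls i a))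
    (_root_.candidates (Ds i a) (_root_.shortWitnesses (Ds i a) (Ls i a)))) hD.length.succ nil
    (validStep (hTL.comp id.fst) (hq.comp id.fst) (hTC.comp id.fst) (hW.comp id.fst)
      (hc.comp id.fst) id.snd) ?_
  -- Every round after the start yields a sublist of the fixed candidate list, which bounds all
  -- intermediate results.
  obtain ⟨k, hk⟩ := hc.size
  refine ⟨k, fun i a m _ => le_trans ?_ (hk i a)⟩
  cases m with
  | zero => exact two_le_sz _
  | succ m =>
    rw [Function.iterate_succ_apply']
    exact List.filter_sublist.sz_le

end PolyTime

/-! ## Correctness of the algorithm -/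

section Correctness

variable {D Q QL QC : Type} [DecidableEq D] [DecidableEq Q] [DecidableEq QL] [DecidableEq QC]

/-- The iterates increase. As long as an iterate is not closed under `E`, each round activates the
source of a further edge, so after `E.length` rounds the list must be closed. -/
theorem mem_reachable (E : List (Q × Q)) (P : List Q) (q' : Q) :
    q' ∈ reachable E P ↔ ∃ q ∈ P, Relation.ReflTransGen (fun a b => (a, b) ∈ E) q q' := by
  unfold reachable
  set F : List Q → List Q := fun R =>
    P ++ (E.filter fun e : Q × Q => decide (e.1 ∈ R)).map fun e => e.2 with hF
  have memF : ∀ R q, q ∈ F R ↔ q ∈ P ∨ ∃ p ∈ R, (p, q) ∈ E := by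
    intro R q
    simp only [hF, List.mem_append, List.mem_map, List.mem_filter, decide_eq_true_eq, Prod.exists]
    exact or_congr_right ⟨fun ⟨a, b, h, e⟩ => ⟨a, h.2, e ▸ h.1⟩, fun ⟨p, h, e⟩ => ⟨p, q, ⟨e, h⟩, rfl⟩⟩
  have hP : ∀ n, P ⊆ F^[n] P := by
    intro n q hq
    cases n with
    | zero => exact hq
    | succ n => rw [Function.iterate_succ_apply', memF]; exact Or.inl hq
  have mono : ∀ n, F^[n] P ⊆ F^[n + 1] P := by
    intro n
    induction n with
    | zero => exact hP 1
    | succ n ih =>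
      intro q hq
      rw [Function.iterate_succ_apply', memF] at hq ⊢
      exact hq.imp_right fun ⟨p, hp, h⟩ => ⟨p, ih hp, h⟩
  -- If a round activates no new edge, every active edge was active before and its target has just
  -- been added, so the new iterate is closed. At `n = E.length` the second alternative would
  -- require more active edges than there are edges.
  have key : ∀ n, (∀ e ∈ E, e.1 ∈ F^[n] P → e.2 ∈ F^[n] P) ∨
      n + 1 ≤ (E.filter fun e : Q × Q => decide (e.1 ∈ F^[n] P)).length := by
    intro n
    induction n with
    | zero =>
      rcases Nat.eq_zero_or_pos (E.filter fun e : Q × Q => decide (e.1 ∈ F^[0] P)).length with h | h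
      · left
        intro e he h1
        have : e ∈ E.filter fun e : Q × Q => decide (e.1 ∈ F^[0] P) :=
          List.mem_filter.2 ⟨he, decide_eq_true h1⟩
        rw [List.length_eq_zero_iff.1 h] at this
        simp at this
      · exact Or.inr h
    | succ n ih =>
      rcases ih with ih | ih
      · left
        have : ∀ q, q ∈ F^[n + 1] P → q ∈ F^[n] P := by
          intro q hq
          rw [Function.iterate_succ_apply', memF] at hq
          rcases hq with hq | ⟨p, hp, h⟩
          · exact hP n hq
          · exact ih _ h hp
        exact fun e he h => mono n (ih e he (this _ h))
      · by_cases h : n + 2 ≤ (E.filter fun e : Q × Q => decide (e.1 ∈ F^[n + 1] P)).length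
        · exact Or.inr h
        · left
          have hsub : (E.filter fun e : Q × Q => decide (e.1 ∈ F^[n] P)).Sublist
              (E.filter fun e : Q × Q => decide (e.1 ∈ F^[n + 1] P)) :=
            List.monotone_filter_right _ fun e he => by
              simp only [decide_eq_true_eq] at he ⊢
              exact mono n he
          have heq := hsub.eq_of_length (by have := hsub.length_le; omega)
          intro e he h1
          have : e ∈ E.filter fun e : Q × Q => decide (e.1 ∈ F^[n] P) := by
            rw [heq]
            exact List.mem_filter.2 ⟨he, decide_eq_true h1⟩
          rw [Function.iterate_succ_apply', memF]
          exact Or.inr ⟨e.1, by simpa using (List.mem_filter.1 this).2, he⟩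
  constructor
  · have : ∀ n q', q' ∈ F^[n] P →
        ∃ q ∈ P, Relation.ReflTransGen (fun a b => (a, b) ∈ E) q q' := by
      intro n
      induction n with
      | zero => exact fun q' h => ⟨q', h, .refl⟩
      | succ n ih =>
        intro q' h
        rw [Function.iterate_succ_apply', memF] at h
        rcases h with h | ⟨p, hp, h⟩
        · exact ⟨q', h, .refl⟩
        · obtain ⟨q, hq, h1⟩ := ih p hp
          exact ⟨q, hq, h1.tail h⟩
    exact this _ q'
  · rintro ⟨q, hq, h⟩
    have hcl : ∀ e ∈ E, e.1 ∈ F^[E.length] P → e.2 ∈ F^[E.length] P := by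
      refine (key E.length).resolve_right fun h => ?_
      have := List.length_filter_le (fun e => decide (e.1 ∈ F^[E.length] P)) E
      omega
    induction h with
    | refl => exact hP _ hq
    | tail _ h ih => exact hcl _ h ih

/-! ### Splitting runs, and the states reached by reading a language -/

namespace Thread

theorem Run.append {P : Thread D Q} {q p r : Q} {u v : List (MemOp D)} (h : P.Run q u p)
    (h' : P.Run p v r) : P.Run q (u ++ v) r := by
  induction h with
  | refl q => exact h'
  | eps ht _ ih => exact .eps ht (ih h')
  | op ht _ ih => exact .op ht (ih h')

theorem Run.of_append {P : Thread D Q} {q r : Q} {u v : List (MemOp D)} (h : P.Run q (u ++ v) r) :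
    ∃ p, P.Run q u p ∧ P.Run p v r := by
  generalize hw : u ++ v = w at h
  induction h generalizing u with
  | refl q =>
    obtain ⟨rfl, rfl⟩ := List.append_eq_nil_iff.1 hw
    exact ⟨q, .refl q, .refl q⟩
  | eps ht _ ih =>
    obtain ⟨p, h1, h2⟩ := ih hw
    exact ⟨p, .eps ht h1, h2⟩
  | @op q q' r o w ht h ih =>
    cases u with
    | nil =>
      rw [List.nil_append] at hw
      exact ⟨q, .refl q, hw ▸ .op ht h⟩
    | cons o' u =>
      rw [List.cons_append, List.cons.injEq] at hw
      obtain ⟨rfl, hw⟩ := hw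
      obtain ⟨p, h1, h2⟩ := ih hw
      exact ⟨p, .op ht h1, h2⟩

theorem Run.of_cons {P : Thread D Q} {q r : Q} {o : MemOp D} {v : List (MemOp D)}
    (h : P.Run q (o :: v) r) :
    ∃ p p', P.Run q [] p ∧ (p, some o, p') ∈ P.trans ∧ P.Run p' v r := by
  generalize hw : o :: v = w at h
  induction h with
  | refl q => cases hw
  | eps ht _ ih =>
    obtain ⟨p, p', h1, h2⟩ := ih hw
    exact ⟨p, p', .eps ht h1, h2⟩
  | @op q q' r o w ht h ih =>
    cases hw
    exact ⟨q, q', .refl q, ht, h⟩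

/-- The states that a thread reaches from `R` by runs whose sequence of read values is in `K`. -/
def post (P : Thread D Q) (K : Language D) (R : Set Q) : Set Q :=
  {q' | ∃ q ∈ R, ∃ w, P.Run q w q' ∧ LCSystem.readsOf w ∈ K}

/-- A run whose reads factor can be cut at a corresponding state. The set of reached states is
therefore all that has to be remembered between two factors of `Expr`. -/
theorem post_mul (P : Thread D Q) (K K' : Language D) (R : Set Q) :
    P.post (K * K') R = P.post K' (P.post K R) := by
  ext q'
  constructor
  · rintro ⟨q, hq, w, hw, h⟩
    obtain ⟨a, ha, b, hb, hab⟩ := Language.mem_mul.1 h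
    obtain ⟨u, v, rfl, h1, h2⟩ := List.filterMap_eq_append_iff.1 hab.symm
    obtain ⟨p, hu, hv⟩ := hw.of_append
    exact ⟨p, ⟨q, hq, u, hu, by rw [LCSystem.readsOf, h1]; exact ha⟩, v, hv,
      by rw [LCSystem.readsOf, h2]; exact hb⟩
  · rintro ⟨p, ⟨q, hq, u, hu, h1⟩, v, hv, h2⟩
    refine ⟨q, hq, u ++ v, hu.append hv, ?_⟩
    rw [LCSystem.readsOf, List.filterMap_append]
    exact Language.append_mem_mul h1 h2

end Thread

theorem mem_readsOf {w : List (MemOp D)} {d : D} : d ∈ LCSystem.readsOf w ↔ MemOp.rd d ∈ w := by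
  unfold LCSystem.readsOf
  rw [List.mem_filterMap]
  constructor
  · rintro ⟨o, ho, h⟩
    cases o with
    | wr a => simp at h
    | rd a =>
      simp only [Option.some.injEq] at h
      exact h ▸ ho
  · exact fun h => ⟨_, h, rfl⟩

/-- The words over `Γ`. -/
def wordsOver (Γ : Set D) : Language D := {u | ∀ d ∈ u, d ∈ Γ}

theorem mem_reach {P : Thread D Q} {T : List (Q × Option (MemOp D) × Q)}
    (hT : ∀ t, t ∈ T ↔ t ∈ P.trans) (Γ : List D) (R : List Q) (q' : Q) :
    q' ∈ reach T Γ R ↔ q' ∈ P.post (wordsOver {d | d ∈ Γ}) {q | q ∈ R} := by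
  unfold reach
  rw [mem_reachable]
  have hE : ∀ a b, (a, b) ∈ (T.filter fun t => (readValue t.2.1).elim true
      fun b => decide (b ∈ Γ)).map (fun t => (t.1, t.2.2)) ↔
      ∃ o, (a, o, b) ∈ P.trans ∧ ∀ d, o = some (MemOp.rd d) → d ∈ Γ := by
    intro a b
    simp only [List.mem_map, List.mem_filter, Prod.exists, Prod.mk.injEq, hT]
    constructor
    · rintro ⟨a', o, b', ⟨h1, h2⟩, rfl, rfl⟩
      refine ⟨o, h1, ?_⟩
      rintro d rfl
      simpa [readValue] using h2
    · rintro ⟨o, h1, h2⟩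
      refine ⟨a, o, b, ⟨h1, ?_⟩, rfl, rfl⟩
      rcases o with _ | _ | d
      · rfl
      · rfl
      · simpa [readValue] using h2 d rfl
  simp only [hE]
  refine exists_congr fun q => and_congr_right' ?_
  constructor
  · intro h
    induction h using Relation.ReflTransGen.head_induction_on with
    | refl => exact ⟨[], .refl _, fun d hd => (List.not_mem_nil hd).elim⟩
    | head h _ ih =>
      obtain ⟨o, ho, hd⟩ := h
      obtain ⟨w, hw, h1⟩ := ih
      rcases o with _ | o
      · exact ⟨w, .eps ho hw, h1⟩
      · refine ⟨o :: w, .op ho hw, fun d hd' => ?_⟩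
        rw [mem_readsOf, List.mem_cons] at hd'
        rcases hd' with rfl | hd'
        · exact hd d rfl
        · exact h1 d (mem_readsOf.2 hd')
  · rintro ⟨w, hw, h⟩
    replace h : ∀ d, MemOp.rd d ∈ w → d ∈ Γ := fun d hd => h d (mem_readsOf.2 hd)
    induction hw with
    | refl q => exact .refl
    | eps ht _ ih => exact .head ⟨none, ht, by simp⟩ (ih h)
    | @op q q' r o w ht _ ih =>
      refine .head ⟨some o, ht, ?_⟩ (ih fun d hd => h d (List.mem_cons_of_mem _ hd))
      rintro d hd
      cases hd
      exact h d List.mem_cons_self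

theorem setOf_mem_reach {P : Thread D Q} {T : List (Q × Option (MemOp D) × Q)}
    (hT : ∀ t, t ∈ T ↔ t ∈ P.trans) (Γ : List D) (R : List Q) :
    {q' | q' ∈ reach T Γ R} = P.post (wordsOver {d | d ∈ Γ}) {q | q ∈ R} :=
  Set.ext (mem_reach hT Γ R)

/-- A loop writing `b` consists of a path from `q` to the source of a transition writing `b` and a
path from its target back to `q`. These are two independent reachability questions for each
transition. -/
theorem mem_loopList {S : LCSystem D QL QC} {T : List (QL × Option (MemOp D) × QL)}
    (hT : ∀ t, t ∈ T ↔ t ∈ S.leader.trans) (q : QL) (Γ : List D) (b : D) :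
    b ∈ loopList T q Γ ↔ b ∈ S.loop q {d | d ∈ Γ} := by
  have h1 : b ∈ loopList T q Γ ↔ ∃ p p', (p, some (MemOp.wr b), p') ∈ S.leader.trans ∧
      p ∈ reach T Γ [q] ∧ q ∈ reach T Γ [p'] := by
    unfold loopList
    simp only [List.mem_flatMap, Prod.exists, hT]
    constructor
    · rintro ⟨p, o, p', ht, hb⟩
      rcases o with _ | a | a
      · simp [writtenValue] at hb
      · simp only [writtenValue, Option.elim_some] at hb
        by_cases h : p ∈ reach T Γ [q] ∧ q ∈ reach T Γ [p']
        · simp only [h.1, h.2, decide_true, Bool.and_true, cond_true, List.mem_singleton] at hb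
          exact ⟨p, p', hb ▸ ht, h⟩
        · rw [← Bool.decide_and, decide_eq_false h] at hb
          simp at hb
      · simp [writtenValue] at hb
    · rintro ⟨p, p', ht, h, h'⟩
      exact ⟨p, _, p', ht, by simp [writtenValue, h, h']⟩
  rw [h1]
  simp only [mem_reach hT, Thread.post, List.mem_singleton, Set.mem_ofPred_eq, exists_eq_left,
    LCSystem.loop, wordsOver]
  constructor
  · rintro ⟨p, p', ht, ⟨u, hu, h2⟩, v, hv, h3⟩
    refine ⟨u, v, hu.append (.op ht hv), fun d hd => ?_⟩
    simp only [List.mem_append, List.mem_cons, reduceCtorEq, false_or] at hd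
    exact hd.elim (fun hd => h2 d (mem_readsOf.2 hd)) (fun hd => h3 d (mem_readsOf.2 hd))
  · rintro ⟨u, v, h, hd⟩
    obtain ⟨r, hu, hv⟩ := h.of_append
    obtain ⟨p, p', h2, ht, hv⟩ := hv.of_cons
    refine ⟨p, p', ht, ⟨u, ?_, fun d h => hd d ?_⟩, v, hv, fun d h => hd d ?_⟩
    · simpa using hu.append h2
    · exact List.mem_append_left _ (mem_readsOf.1 h)
    · exact List.mem_append_right _ (List.mem_cons_of_mem _ (mem_readsOf.1 h))

theorem mem_availList (x : Witness D Q) (α : List D) (i : ℕ) (b : D) :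
    b ∈ availList x α i ↔ b ∈ x.avail α i := by
  unfold availList Witness.avail
  simp only [List.mem_flatMap, List.mem_range, Set.mem_ofPred_eq]
  constructor
  · rintro ⟨l, hl, hb⟩
    rcases h1 : α[l]? with _ | b' <;> rw [h1] at hb
    · simp at hb
    · rcases h2 : x.pos[l]? with _ | p <;> rw [h2] at hb
      · simp at hb
      · by_cases h : p ≤ i <;> simp [h] at hb
        exact ⟨l, p, hb ▸ h1, h2, h⟩
  · rintro ⟨l, p, h1, h2, h⟩
    exact ⟨l, (List.getElem?_eq_some_iff.1 h1).1, by simp [h1, h2, h]⟩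

theorem setOf_mem_availList (x : Witness D Q) (α : List D) (i : ℕ) :
    {b | b ∈ availList x α i} = x.avail α i :=
  Set.ext (mem_availList x α i)

theorem mem_gammaList {S : LCSystem D QL QC} {T : List (QL × Option (MemOp D) × QL)}
    (hT : ∀ t, t ∈ T ↔ t ∈ S.leader.trans) (x : Witness D QL) (α : List D) (i : ℕ) (b : D) :
    b ∈ gammaList T x α i ↔ b ∈ S.gamma x α i := by
  unfold gammaList LCSystem.gamma Witness.letter
  rw [List.mem_append, mem_availList, Set.mem_ofPred_eq]
  refine or_congr_left ?_
  rcases x.word[i - 1]? with _ | ⟨q, a⟩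
  · simp
  · rw [Option.elim_some, mem_loopList hT, setOf_mem_availList]
    exact ⟨fun h => ⟨q, a, rfl, h⟩, by rintro ⟨q', a', h, h'⟩; cases h; exact h'⟩

theorem gammaStar_eq {S : LCSystem D QL QC} {T : List (QL × Option (MemOp D) × QL)}
    (hT : ∀ t, t ∈ T ↔ t ∈ S.leader.trans) (x : Witness D QL) (α : List D) (i : ℕ) :
    S.gammaStar x α i = wordsOver {d | d ∈ gammaList T x α i} := by
  ext u
  refine Language.mem_kstar.trans ?_
  constructor
  · rintro ⟨L, rfl, hL⟩ d hd
    obtain ⟨y, hy, hd⟩ := List.mem_flatten.1 hd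
    obtain ⟨b, hb, rfl⟩ := hL y hy
    rw [List.mem_singleton.1 hd]
    exact (mem_gammaList hT x α i b).2 hb
  · intro h
    refine ⟨u.map fun d => [d], ?_, fun y hy => ?_⟩
    · induction u with
      | nil => rfl
      | cons d u ih =>
        rw [List.map_cons, List.flatten_cons, ← ih fun d hd => h d (List.mem_cons_of_mem _ hd)]
        rfl
    · obtain ⟨d, hd, rfl⟩ := List.mem_map.1 hy
      exact ⟨d, (mem_gammaList hT x α i d).1 (h d hd), rfl⟩

theorem wordsOver_nil : wordsOver {d : D | d ∈ ([] : List D)} = 1 := by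
  ext u
  rw [Language.mem_one]
  exact ⟨fun h => List.eq_nil_iff_forall_not_mem.2 fun d hd => by simpa using h d hd,
    by rintro rfl; exact fun d hd => by simp at hd⟩

theorem setOf_mem_readStep {P : Thread D Q} {T : List (Q × Option (MemOp D) × Q)}
    (hT : ∀ t, t ∈ T ↔ t ∈ P.trans) (a : Option D) (R : List Q) :
    {q | q ∈ readStep T a R} =
      P.post {u | u = [] ∨ ∃ b, a = some b ∧ u = [b]} {q | q ∈ R} := by
  ext q'
  have h0 : ∀ R q', q' ∈ reach T [] R ↔ ∃ q ∈ R, ∃ w, P.Run q w q' ∧ LCSystem.readsOf w = [] := by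
    intro R q'
    rw [mem_reach hT, wordsOver_nil]
    rfl
  have h1 : ∀ q, (q ∈ a.elim [] fun b => (T.filter fun t =>
      decide (readValue t.2.1 = some b) && decide (t.1 ∈ reach T [] R)).map fun t => t.2.2) ↔
      ∃ b, a = some b ∧ ∃ p ∈ reach T [] R, (p, some (MemOp.rd b), q) ∈ P.trans := by
    intro q
    rcases a with _ | b
    · simp
    · simp only [Option.elim_some, List.mem_map, List.mem_filter, Bool.and_eq_true,
        decide_eq_true_eq, Prod.exists, Option.some.injEq, exists_eq_left', hT]
      constructor
      · rintro ⟨p, o, q', ⟨ht, ho, hp⟩, rfl⟩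
        rcases o with _ | _ | d
        · simp [readValue] at ho
        · simp [readValue] at ho
        · simp only [readValue, Option.some.injEq] at ho
          exact ⟨p, hp, ho ▸ ht⟩
      · rintro ⟨p, hp, ht⟩
        exact ⟨p, _, q, ⟨ht, rfl, hp⟩, rfl⟩
  unfold readStep Thread.post
  rw [Set.mem_ofPred_eq, Set.mem_ofPred_eq, h0]
  simp only [List.mem_append, h1, h0]
  constructor
  · rintro ⟨q, ⟨p, hp, u, hu, h2⟩ | ⟨b, rfl, r, ⟨p, hp, u, hu, h2⟩, ht⟩, w, hw, h3⟩
    · refine ⟨p, hp, u ++ w, hu.append hw, Or.inl ?_⟩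
      rw [LCSystem.readsOf, List.filterMap_append]
      exact List.append_eq_nil_iff.2 ⟨h2, h3⟩
    · refine ⟨p, hp, u ++ MemOp.rd b :: w, hu.append (.op ht hw), Or.inr ⟨b, rfl, ?_⟩⟩
      unfold LCSystem.readsOf at *
      rw [List.filterMap_append, h2, List.filterMap_cons, h3]
      rfl
  · rintro ⟨q, hq, w, hw, h | ⟨b, rfl, h⟩⟩
    · exact ⟨q, Or.inl ⟨q, hq, [], .refl q, rfl⟩, w, hw, h⟩
    -- The run is cut at its only read `o`; the parts `u` and `v` read nothing.
    · obtain ⟨u, o, v, rfl, h2, h3, h4⟩ := List.filterMap_eq_cons_iff.1 h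
      obtain ⟨r, hu, hv⟩ := hw.of_append
      cases o with
      | wr d => simp at h3
      | rd d =>
        obtain ⟨p, p', h5, ht, hv⟩ := hv.of_cons
        simp only [Option.some.injEq] at h3
        subst h3
        refine ⟨p', Or.inr ⟨d, rfl, p, ⟨q, hq, u, ?_, ?_⟩, ht⟩, v, hv, h4⟩
        · simpa using hu.append h5
        · exact List.filterMap_eq_nil_iff.2 h2

/-- The trailing closure under `Γ` makes the induction work: for `n = 0` the bare list `R` need not
be closed under moves that read nothing. A general `Γ` lets the induction hypothesis be applied to
`Γ_{n+1}`, and later it becomes the last factor `Γ_j^*`. -/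
theorem setOf_mem_reach_exprStates {S : LCSystem D QL QC}
    {TL : List (QL × Option (MemOp D) × QL)} {TC : List (QC × Option (MemOp D) × QC)}
    (hTL : ∀ t, t ∈ TL ↔ t ∈ S.leader.trans) (hTC : ∀ t, t ∈ TC ↔ t ∈ S.contrib.trans)
    (x : Witness D QL) (α : List D) (R : List QC) (n : ℕ) (Γ : List D) :
    {q | q ∈ reach TC Γ (exprStates TL TC x α R n)} =
      S.contrib.post (((List.range n).map fun i =>
        S.gammaStar x α (i + 1) * LCSystem.optWrite x (i + 1)).prod * wordsOver {d | d ∈ Γ})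
        {q | q ∈ R} := by
  induction n generalizing Γ with
  | zero => simp [setOf_mem_reach hTC, exprStates]
  | succ n ih =>
    have h : exprStates TL TC x α R (n + 1) = readStep TC (x.word[n]?.elim none fun l => l.2)
        (reach TC (gammaList TL x α (n + 1)) (exprStates TL TC x α R n)) := by
      simp [exprStates, List.range_succ]
    have hw : LCSystem.optWrite x (n + 1) =
        {u | u = [] ∨ ∃ b, (x.word[n]?.elim none fun l => l.2) = some b ∧ u = [b]} := by
      unfold LCSystem.optWrite Witness.letter
      ext u
      refine or_congr_right ?_
      rw [Nat.add_sub_cancel]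
      rcases x.word[n]? with _ | ⟨q, a⟩
      · simp
      · exact ⟨fun ⟨q', b, h, hu⟩ => ⟨b, by cases h; rfl, hu⟩,
          fun ⟨b, h, hu⟩ => ⟨q, b, by rw [← h]; rfl, hu⟩⟩
    rw [setOf_mem_reach hTC, h, setOf_mem_readStep hTC, ih, ← hw, List.range_succ, List.map_append,
      List.prod_append, ← Thread.post_mul, ← Thread.post_mul, List.map_singleton,
      List.prod_singleton, gammaStar_eq hTL]
    simp only [mul_assoc]

/-- The last index is enough, since the recursion for short witnesses only asks for the newest first
write. The language intersection is nonempty exactly if a state with a transition writing the last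
value is among the computed states. -/
theorem cValidTest_iff {S : LCSystem D QL QC}
    {TL : List (QL × Option (MemOp D) × QL)} {TC : List (QC × Option (MemOp D) × QC)}
    (hTL : ∀ t, t ∈ TL ↔ t ∈ S.leader.trans) (hTC : ∀ t, t ∈ TC ↔ t ∈ S.contrib.trans)
    (β : List D) (x : Witness D QL) :
    cValidTest TL S.contrib.start TC β x = true ↔ S.CValidAt β.length β x := by
  unfold cValidTest LCSystem.CValidAt
  rw [Bool.and_eq_true, decide_eq_true_eq, ← List.dropLast_eq_take]
  refine and_congr_right fun hβ => ?_
  unfold LCSystem.expr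
  rcases hj : x.pos[β.dropLast.length]? with _ | j
  · exact ⟨fun h => by simp at h, fun ⟨u, ⟨j, h, _⟩, _⟩ => by cases h⟩
  have hs := setOf_mem_reach_exprStates hTL hTC x β.dropLast [S.contrib.start] (j - 1)
    (gammaList TL x β.dropLast j)
  rw [← gammaStar_eq hTL] at hs
  have hs : ∀ p, p ∈ reach TC (gammaList TL x β.dropLast j)
      (exprStates TL TC x β.dropLast [S.contrib.start] (j - 1)) ↔ _ := fun p => Set.ext_iff.1 hs p
  simp only [Option.elim_some]
  rcases hb : β[β.length - 1]? with _ | b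
  · simp only [Option.elim_none, LCSystem.traceC, LCSystem.writers, hb]
    simp
  simp only [Option.elim_some, List.any_eq_true, Bool.and_eq_true, decide_eq_true_eq, Prod.exists,
    hs, hTC]
  constructor
  · rintro ⟨p, o, p', ht, ho, q, hq, w, hw, hu⟩
    rw [Set.mem_ofPred_eq, List.mem_singleton] at hq
    subst hq
    refine ⟨_, ⟨j, rfl, hu⟩, w, ⟨p, ⟨b, p', hb, ?_⟩, hw⟩, rfl⟩
    rcases o with _ | d | _
    · simp [writtenValue] at ho
    · simp only [writtenValue, Option.some.injEq] at ho
      exact ho ▸ ht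
    · simp [writtenValue] at ho
  · rintro ⟨u, ⟨j', hj', hu⟩, w, ⟨p, ⟨b', p', hb', ht⟩, hw⟩, rfl⟩
    cases hj'
    rw [hb] at hb'
    cases hb'
    exact ⟨p, _, p', ht, rfl, _, List.mem_singleton_self _, w, hw, hu⟩

theorem lValidTest_iff {S : LCSystem D QL QC} {T : List (QL × Option (MemOp D) × QL)}
    (hT : ∀ t, t ∈ T ↔ t ∈ S.leader.trans) (β : List D) (x : Witness D QL) :
    lValidTest T β x = true ↔ S.LValid β x := by
  unfold lValidTest LCSystem.LValid Witness.letter Witness.state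
  rw [Bool.and_eq_true, decide_eq_true_eq]
  refine and_congr_right fun hβ => ?_
  have key : ∀ (m : ℕ) (q q' : QL) (a : Option D),
      (a.elim (decide (q = q') || (decide ((q, none, q') ∈ T) ||
          T.any fun t => decide (t.1 = q) && decide (t.2.2 = q') &&
            (readValue t.2.1).elim false fun b => decide (b ∈ availList x β m)))
        (fun b => decide ((q, some (MemOp.wr b), q') ∈ T)) = true) ↔
      match a with
      | some b => (q, some (MemOp.wr b), q') ∈ S.leader.trans
      | none => q = q' ∨ (q, none, q') ∈ S.leader.trans ∨
          ∃ b ∈ x.avail β m, (q, some (MemOp.rd b), q') ∈ S.leader.trans := by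
    intro m q q' a
    rcases a with _ | b
    · simp only [Option.elim_none, Bool.or_eq_true, decide_eq_true_eq, hT, List.any_eq_true,
        Bool.and_eq_true, Prod.exists]
      refine or_congr_right (or_congr_right ⟨?_, ?_⟩)
      · rintro ⟨p, o, p', ht, ⟨rfl, rfl⟩, h⟩
        rcases o with _ | _ | b
        · simp [readValue] at h
        · simp [readValue] at h
        · simp only [readValue, Option.elim_some, decide_eq_true_eq, mem_availList] at h
          exact ⟨b, h, ht⟩
      · rintro ⟨b, hb, ht⟩
        exact ⟨q, _, q', ht, ⟨rfl, rfl⟩, by simpa [readValue, mem_availList] using hb⟩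
    · simp [hT]
  rw [List.all_eq_true]
  constructor
  · rintro h i q q' a hi h1 h2
    -- Positions count from `1` and list indices from `0`; the hypothesis `1 ≤ i` keeps the
    -- truncated `i - 1` honest.
    obtain ⟨m, rfl⟩ : ∃ m, i = m + 1 := ⟨i - 1, by omega⟩
    rw [Nat.add_sub_cancel] at h1 h2
    have := h m (List.mem_range.2 (List.getElem?_eq_some_iff.1 h1).1)
    rw [h1, Option.elim_some] at this
    change ((x.word.map Prod.fst ++ [x.target])[m + 1]?).elim true _ = true at this
    rw [h2, Option.elim_some] at this
    exact (key _ _ _ _).1 this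
  · intro h m hm
    rcases h1 : x.word[m]? with _ | ⟨q, a⟩
    · rfl
    · rw [Option.elim_some]
      change ((x.word.map Prod.fst ++ [x.target])[m + 1]?).elim true _ = true
      rcases h2 : (x.word.map Prod.fst ++ [x.target])[m + 1]? with _ | q'
      · rfl
      · exact (key _ _ _ _).2 (h (m + 1) q q' a (by omega) h1 h2)

end Correctness

/-! ### Enumeration of the candidates and correctness of the rounds -/

section Enumeration

variable {D Q QL QC : Type} [DecidableEq D] [DecidableEq Q] [DecidableEq QL] [DecidableEq QC]

theorem allLists_succ {α : Type} (A : List α) (n : ℕ) :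
    allLists A (n + 1) = [] :: A.flatMap fun a => (allLists A n).map fun l => a :: l :=
  Function.iterate_succ_apply' _ _ _

theorem mem_allLists {α : Type} (A : List α) (n : ℕ) (l : List α) :
    l ∈ allLists A n ↔ l.length ≤ n ∧ ∀ a ∈ l, a ∈ A := by
  induction n generalizing l with
  | zero =>
    rw [allLists, Function.iterate_zero_apply, List.mem_singleton, Nat.le_zero,
      List.length_eq_zero_iff]
    exact ⟨fun h => ⟨h, by simp [h]⟩, fun h => h.1⟩
  | succ n ih =>
    rw [allLists_succ]
    cases l with
    | nil => simp
    | cons a l =>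
      simp only [List.mem_cons, reduceCtorEq, List.mem_flatMap, List.mem_map, List.cons.injEq, ih,
        false_or, List.length_cons, Nat.add_le_add_iff_right, forall_eq_or_imp]
      constructor
      · rintro ⟨b, hb, m, hm, rfl, rfl⟩
        exact ⟨hm.1, hb, hm.2⟩
      · rintro ⟨h1, h2, h3⟩
        exact ⟨a, h2, l, ⟨h1, h3⟩, rfl, rfl⟩

theorem nodup_allLists {α : Type} {A : List α} (hA : A.Nodup) (n : ℕ) : (allLists A n).Nodup := by
  induction n with
  | zero => exact List.nodup_singleton _
  | succ n ih =>
    rw [allLists_succ, List.nodup_cons]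
    refine ⟨by simp, List.nodup_flatMap.2 ⟨fun a _ => ih.map (List.cons_injective),
      hA.imp fun {a b} hab l hl hl' => ?_⟩⟩
    obtain ⟨m, _, rfl⟩ := List.mem_map.1 hl
    obtain ⟨m', _, h⟩ := List.mem_map.1 hl'
    exact hab (List.cons.inj h).1.symm

theorem firstRepetition_eq_none_iff (l : List Q) :
    (!(Witness.firstRepetition l).isSome) = true ↔ l.Nodup := by
  induction l with
  | nil => simp [Witness.firstRepetition]
  | cons q l ih =>
    rw [Witness.firstRepetition, List.nodup_cons, ← ih]
    split_ifs with h <;> simp [h]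

/-- The fold compares neighbours only, which suffices by transitivity. Its initial value `0` imposes
no condition on the first entry. -/
theorem isPosList_iff (n : ℕ) (l : List ℕ) :
    isPosList n l = true ↔ l.Pairwise (· ≤ ·) ∧ ∀ p ∈ l, 1 ≤ p ∧ p ≤ n := by
  have key : ∀ (l : List ℕ) (b : Bool) (m : ℕ),
      (l.foldl (fun (s : Bool × ℕ) p => (s.1 && decide (s.2 ≤ p), p)) (b, m)).1 = true ↔
        b = true ∧ (m :: l).Pairwise (· ≤ ·) := by
    intro l
    induction l with
    | nil => simp
    | cons p l ih =>
      intro b m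
      rw [List.foldl_cons, ih, Bool.and_eq_true, decide_eq_true_eq, and_assoc,
        ← List.isChain_iff_pairwise, ← List.isChain_iff_pairwise, List.isChain_cons_cons]
  unfold isPosList
  rw [Bool.and_eq_true, key, and_comm]
  simp

/-- The length bounds of the enumeration lose nothing: distinct states force the word to have length
at most `|Q|`, and the positions, bounded by that length, lie in `List.range (|Q| + 1)`. -/
theorem mem_shortWitnesses [Fintype D] [Fintype Q] {Ds : List D} {Ls : List Q} (hD : ∀ d, d ∈ Ds)
    (hD' : Ds.length = Fintype.card D) (hL : ∀ q, q ∈ Ls) (hL' : Ls.length = Fintype.card Q)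
    (x : Witness D Q) : x ∈ shortWitnesses Ds Ls ↔ x ∈ Witness.shortOfOrder D Q x.ord := by
  unfold shortWitnesses Witness.shortOfOrder Witness.IsWitness Witness.ord
  obtain ⟨w, q, σ⟩ := x
  have h1 : ∀ l : Q × Option D, l ∈ Ls.product (none :: Ds.map fun d => some d) := by
    rintro ⟨q, o⟩
    refine List.pair_mem_product.2 ⟨hL q, ?_⟩
    cases o <;> simp [hD]
  simp only [List.mem_map, List.mem_filter, Prod.exists, List.pair_mem_product, mem_allLists,
    firstRepetition_eq_none_iff, isPosList_iff, Witness.mk.injEq, List.mem_range, h1, hL,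
    Set.mem_ofPred_eq, hD', hL']
  constructor
  · rintro ⟨w', q', σ', ⟨⟨⟨⟨h2, -⟩, h3⟩, -, h4, h5⟩, h6, h7⟩, rfl, rfl, rfl⟩
    exact ⟨⟨h6, h7, h4⟩, h3, trivial⟩
  · rintro ⟨⟨h2, h3, h4⟩, h5, -⟩
    have h6 : w.length ≤ Fintype.card Q := by simpa using h5.length_le_card
    exact ⟨w, q, σ, ⟨⟨⟨⟨h6, fun _ _ => trivial⟩, h5⟩, trivial, h4, fun p hp => by
      have := h3 p hp; omega⟩, h2, h3⟩, rfl, rfl, rfl⟩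

theorem nodup_shortWitnesses {Ds : List D} {Ls : List Q} (hD : Ds.Nodup) (hL : Ls.Nodup) :
    (shortWitnesses Ds Ls).Nodup := by
  have h1 : (none :: Ds.map fun d => some d).Nodup := by
    rw [List.nodup_cons]
    exact ⟨by simp, hD.map (Option.some_injective D)⟩
  refine List.Nodup.map (fun a b h => ?_) (((nodup_allLists (hL.product h1) _).filter _).product
    (hL.product (nodup_allLists List.nodup_range _)) |>.filter _)
  simp only [Witness.mk.injEq] at h
  exact Prod.ext h.1 (Prod.ext h.2.1 h.2.2)

theorem mem_candidates [Fintype D] {Ds : List D} (hD : ∀ d, d ∈ Ds)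
    (hD' : Ds.length = Fintype.card D) (W : List (Witness D Q)) (p : List D × Witness D Q) :
    p ∈ candidates Ds W ↔ p.1 ∈ firstWriteSeqs D ∧ p.2 ∈ W ∧ p.2.ord = p.1.length := by
  unfold candidates firstWriteSeqs Witness.ord
  obtain ⟨β, z⟩ := p
  simp only [List.mem_filter, List.pair_mem_product, mem_allLists, firstRepetition_eq_none_iff, hD,
    hD', implies_true, and_true, decide_eq_true_eq, Set.mem_ofPred_eq]
  tauto

theorem nodup_candidates {Ds : List D} {W : List (Witness D Q)} (hD : Ds.Nodup) (hW : W.Nodup) :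
    (candidates Ds W).Nodup :=
  (((nodup_allLists hD _).filter _).product hW).filter _

theorem isListing_validList [Fintype D] [Fintype QL] {Ds : List D} {Ls : List QL}
    (hD : ∀ d, d ∈ Ds) (hD' : Ds.Nodup) (hL : ∀ q, q ∈ Ls) (hL' : Ls.Nodup)
    {S : LCSystem D QL QC} {TL : List (QL × Option (MemOp D) × QL)}
    {TC : List (QC × Option (MemOp D) × QC)} (hTL : ∀ t, t ∈ TL ↔ t ∈ S.leader.trans)
    (hTC : ∀ t, t ∈ TC ↔ t ∈ S.contrib.trans) :
    IsListing S.validShortWitnesses (validList Ds Ls TL S.contrib.start TC) := by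
  have cD : Ds.length = Fintype.card D := by
    rw [← List.toFinset_card_of_nodup hD', Finset.eq_univ_iff_forall.2
      fun d => List.mem_toFinset.2 (hD d), Finset.card_univ]
  have cL : Ls.length = Fintype.card QL := by
    rw [← List.toFinset_card_of_nodup hL', Finset.eq_univ_iff_forall.2
      fun d => List.mem_toFinset.2 (hL d), Finset.card_univ]
  have mW := mem_shortWitnesses hD cD hL cL
  have mW' : ∀ k x, x ∈ Witness.shortOfOrder D QL k ↔ x ∈ shortWitnesses Ds Ls ∧ x.ord = k := by
    intro k x
    rw [mW]
    exact ⟨fun h => ⟨h.2.2.symm ▸ h, h.2.2⟩, fun h => h.2 ▸ h.1⟩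
  have mC := mem_candidates hD cD (shortWitnesses Ds Ls)
  -- Every round filters the full candidate list again, so `n` rounds yield all valid pairs with
  -- sequences shorter than `n`, and not just those of one length.
  have step : ∀ n p, p ∈ (validStep TL S.contrib.start TC (shortWitnesses Ds Ls)
      (candidates Ds (shortWitnesses Ds Ls)))^[n] [] ↔
      p ∈ S.validShortWitnesses ∧ p.1.length < n := by
    intro n
    induction n with
    | zero => simp
    | succ n ih =>
      rintro ⟨β, z⟩
      rw [Function.iterate_succ_apply', validStep, List.mem_filter, mC]
      unfold LCSystem.validShortWitnesses
      rw [Set.mem_ofPred_eq, mW']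
      dsimp only
      simp only [and_assoc]
      refine and_congr_right fun hβ => and_congr_right fun hz => and_congr_right fun hzβ => ?_
      rcases β.eq_nil_or_concat' with rfl | ⟨β', b, rfl⟩
      · simp [LCSystem.ValidShOfOrder, lValidTest_iff hTL]
      · have hlen : (β' ++ [b]).length = β'.length + 1 := by simp
        have hemp : (β' ++ [b]).isEmpty = false := by simp
        rw [hemp, cond_false, hlen, LCSystem.ValidShOfOrder, Nat.add_lt_add_iff_right]
        simp only [List.any_eq_true, Bool.and_eq_true, decide_eq_true_eq, lValidTest_iff hTL,
          cValidTest_iff hTL hTC, ih, List.dropLast_concat, hlen]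
        have hM : ∀ x y : Witness D QL, (y.word.head?.elim false fun l =>
            decide (l.1 = x.target)) = true ↔ x.Matches y := by
          intro x y
          unfold Witness.Matches
          rcases y.word with _ | ⟨⟨q, a⟩, w⟩
          · simp
          · simp only [List.head?_cons, Option.elim_some, decide_eq_true_eq, List.cons.injEq,
              Prod.mk.injEq]
            exact ⟨fun h => ⟨a, w, ⟨h, rfl⟩, rfl⟩, fun ⟨_, _, h, _⟩ => h.1⟩
        simp only [hM, mW']
        -- The previous round contains only pairs with a first-write sequence, so looking up `(β',
        -- x)` requires that the prefix is one.
        have hβ' : β' ∈ firstWriteSeqs D := by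
          unfold firstWriteSeqs at hβ ⊢
          rw [Set.mem_ofPred_eq] at hβ ⊢
          exact ⟨hβ.1.of_append_left, by have := hβ.2; omega⟩
        constructor
        · rintro ⟨x, hx, y, hy, ⟨⟨⟨⟨h1, h2⟩, h3⟩, h4⟩, h5⟩, h6, h7⟩
          rw [LCSystem.validShortWitnesses, Set.mem_ofPred_eq, mW'] at h6
          exact ⟨⟨x, ⟨hx, h6.2.1.2⟩, y, ⟨hy, h1⟩, h2, h3, h4, h5, h6.2.2⟩, h7⟩
        · rintro ⟨⟨x, ⟨hx, hx'⟩, y, ⟨hy, h1⟩, h2, h3, h4, h5, h6⟩, h7⟩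
          refine ⟨x, hx, y, hy, ⟨⟨⟨⟨h1, h2⟩, h3⟩, h4⟩, h5⟩, ?_, h7⟩
          rw [LCSystem.validShortWitnesses, Set.mem_ofPred_eq, mW']
          exact ⟨hβ', ⟨hx, hx'⟩, h6⟩
  constructor
  · unfold validList
    rw [Function.iterate_succ_apply', validStep]
    exact (nodup_candidates hD' (nodup_shortWitnesses hD' hL')).filter _
  · intro p
    rw [validList, step]
    refine ⟨fun h => h.1, fun h => ⟨h, ?_⟩⟩
    -- Sequences have length at most `D`, hence are strictly shorter than the number `D + 1` of
    -- rounds.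
    have : p.1.length ≤ Fintype.card D := h.1.2
    omega

end Enumeration

/-! ## Padding -/

/-- The type of the encoded input for given sizes `(L, D, C)`. -/
abbrev LCInput (i : ℕ × ℕ × ℕ) : Type :=
  (ℕ × Fin i.2.1) ×
  (ℕ × Fin i.1 × List (Fin i.1 × Option (MemOp (Fin i.2.1)) × Fin i.1)) ×
  (ℕ × Fin i.2.2 × List (Fin i.2.2 × Option (MemOp (Fin i.2.1)) × Fin i.2.2))

/-- An input whose sizes are recorded correctly; its encoding is preceded by the number
`(L + D) ^ (L + D)` in unary. -/
structure PaddedInput (i : ℕ × ℕ × ℕ) where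
  input : LCInput i
  sizeD : input.1.1 = i.2.1
  sizeL : input.2.1.1 = i.1

instance (i : ℕ × ℕ × ℕ) : ToVal (PaddedInput i) :=
  ⟨fun a => toVal ((i.1 + i.2.1) ^ (i.1 + i.2.1), a.input)⟩

theorem toVal_map_val {n : ℕ} (l : List (Fin n)) : toVal (l.map Fin.val) = toVal l := by
  induction l with
  | nil => rfl
  | cons a l ih => exact congrArg (Val.cons _) ih

/-- This lets a program list all elements of `Fin n` from the unary number `n`. -/
theorem toVal_range (n : ℕ) : toVal (List.range n) = toVal (List.finRange n) := by
  rw [← toVal_map_val, List.map_coe_finRange_eq_range]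

/-- A polynomial factor in the base moves outside the power: `(N ^ 3) ^ N = (N ^ N) ^ 3`. With `N =
L + D`, all enumerations are thus polynomial in the padding. -/
theorem pow_le_pad_pow {b e N : ℕ} (hN : 1 ≤ N) (hb : b ≤ N ^ 3) (he : e ≤ N) :
    b ^ e ≤ (N ^ N) ^ 3 :=
  calc b ^ e ≤ (N ^ 3) ^ e := Nat.pow_le_pow_left hb e
    _ ≤ (N ^ 3) ^ N := Nat.pow_le_pow_right (Nat.pow_pos hN) he
    _ = (N ^ N) ^ 3 := by rw [← pow_mul, ← pow_mul, Nat.mul_comm]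

theorem PaddedInput.pow_le {i : ℕ × ℕ × ℕ} (a : PaddedInput i) {b e : ℕ}
    (hb : 1 ≤ i.1 → 1 ≤ i.2.1 → b ≤ (i.1 + i.2.1) ^ 3) (he : e ≤ i.1 + i.2.1) :
    b ^ e ≤ sz a ^ 3 := by
  -- The initial memory value and the initial leader state show that neither size is zero.
  have hD : 1 ≤ i.2.1 := Fin.pos a.input.1.2
  have hL : 1 ≤ i.1 := Fin.pos a.input.2.1.2.1
  refine (pow_le_pad_pow (by omega) (hb hL hD) he).trans (Nat.pow_le_pow_left ?_ 3)
  change _ ≤ sz ((i.1 + i.2.1) ^ (i.1 + i.2.1)) + sz a.input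
  rw [sz_nat]
  omega

theorem polyTime_validList : PolyTime (fun i (a : PaddedInput i) =>
    validList (List.finRange i.2.1) (List.finRange i.1) a.input.2.1.2.2 a.input.2.2.2.1
      a.input.2.2.2.2) := by
  have h : PolyTime (fun i (a : PaddedInput i) => a.input) :=
    PolyTime.id.val.vright.congrVal fun _ _ => rfl
  -- A program has no access to the index `i`; the sizes must be read off the input, where `sizeD`
  -- and `sizeL` guarantee that they are correct.
  have hD : PolyTime (fun i (a : PaddedInput i) => List.finRange i.2.1) :=
    h.fst.fst.range.congrVal fun i a => by rw [a.sizeD, toVal_range]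
  have hL : PolyTime (fun i (a : PaddedInput i) => List.finRange i.1) :=
    h.snd.fst.fst.range.congrVal fun i a => by rw [a.sizeL, toVal_range]
  refine PolyTime.validList hD hL h.snd.fst.snd.snd h.snd.snd.snd.fst h.snd.snd.snd.snd
    ⟨3, fun i a => ?_⟩ ⟨3, fun i a => ?_⟩ ⟨3, fun i a => ?_⟩
  · refine a.pow_le (fun hL hD => ?_) (by simp)
    change (List.finRange i.1 ×ˢ (none :: (List.finRange i.2.1).map some)).length + 1 ≤ _
    simp only [List.length_product, List.length_finRange, List.length_cons, List.length_map]
    nlinarith [Nat.mul_le_mul hL hD, sq_nonneg (i.1 + i.2.1), Nat.zero_le (i.1 * i.2.1)]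
  · refine a.pow_le (fun hL hD => ?_) (by simp)
    simp only [List.length_range, List.length_finRange]
    have : 2 * 2 * (i.1 + i.2.1) ≤ (i.1 + i.2.1) ^ 3 := by
      rw [pow_succ, pow_two]
      exact Nat.mul_le_mul_right _ (Nat.mul_le_mul (by omega) (by omega))
    omega
  · refine a.pow_le (fun hL hD => ?_) (by simp)
    simp only [List.length_finRange]
    have := Nat.le_self_pow (n := 3) (by norm_num) (i.1 + i.2.1)
    omega

/-- The padding can be computed with a bounded number of steps. -/
theorem exists_pad_prog : ∃ (p : Prog) (c : ℕ), ∀ (i : ℕ × ℕ × ℕ) (a : PaddedInput i),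
    ∃ t ≤ sz a ^ c, p.Runs (toVal a.input) (toVal a) t := by
  -- The power is not polynomial in the unpadded input, so only the start and the body of the loop
  -- come from `PolyTime`; the loop itself is estimated by the size of its result. The store is `(N,
  -- acc, n)`, initially `(N, 1, N)`.
  obtain ⟨pi, Ti, ⟨ki, hTi⟩, hpi⟩ := (PolyTime.pair (PolyTime.id.snd.fst.fst.add
    PolyTime.id.fst.fst) ((PolyTime.natConst 1).pair (PolyTime.id.snd.fst.fst.add
    PolyTime.id.fst.fst)) : PolyTime (fun i (a : LCInput i) =>
      (a.2.1.1 + a.1.1, 1, a.2.1.1 + a.1.1))).runs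
  obtain ⟨pf, Tf, ⟨kf, hTf⟩, hpf⟩ := (PolyTime.pair PolyTime.id.fst
    ((PolyTime.id.snd.fst.mul PolyTime.id.fst).pair PolyTime.id.snd.snd.pred) :
    PolyTime (fun (_ : Unit) (s : ℕ × ℕ × ℕ) => (s.1, s.2.1 * s.1, s.2.2 - 1))).runs
  -- The product `acc * N ^ n` is invariant. As `M` bounds it as well as `N` and `n`, the three
  -- unary components have total size at most `6 * M + 6`. A pass costs four steps on top of the
  -- body.
  have hloop : ∀ N n acc M : ℕ, 2 ≤ N → N ≤ M → n ≤ M → acc * N ^ n ≤ M →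
      ∃ t ≤ (n + 1) * ((6 * M + 6) ^ kf + 4),
        (Prog.loop (.seq .snd .snd) pf).Runs (toVal (N, acc, n)) (toVal (N, acc * N ^ n, 0)) t := by
    intro N n
    induction n with
    | zero =>
      intro acc M h2 hN hn hM
      refine ⟨1 + 1 + 1 + 1, by omega, ?_⟩
      rw [pow_zero, mul_one]
      exact .loop_exit (.seq (.snd_cons _ _) (.snd_cons _ _))
    | succ n ih =>
      intro acc M h2 hN hn hM
      have hM' : acc * N * N ^ n ≤ M := by rwa [pow_succ', ← mul_assoc] at hM
      have hacc : acc ≤ M :=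
        (Nat.le_mul_of_pos_right _ (Nat.pow_pos (by omega))).trans hM
      obtain ⟨t, ht, h3⟩ := ih (acc * N) M h2 hN (by omega) hM'
      obtain ⟨u, hu, h4⟩ := hpf () (N, acc, n + 1)
      have hsz : sz (N, acc, n + 1) ≤ 6 * M + 6 := by
        simp only [sz_prod, sz_nat]
        omega
      have h5 : u ≤ (6 * M + 6) ^ kf := hu.trans ((hTf _ _).trans (Nat.pow_le_pow_left hsz _))
      refine ⟨1 + 1 + 1 + u + t + 1, ?_, ?_⟩
      · rw [Nat.add_mul (n + 1) 1, one_mul]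
        omega
      · rw [pow_succ', ← mul_assoc]
        exact .loop_step (.seq (.snd_cons _ _) (.snd_cons _ _)) h4 h3
  refine ⟨.pair (.seq pi (.seq (.loop (.seq .snd .snd) pf) (.seq .snd .fst))) .skip,
    ki + 2 * kf + 5, ?_⟩
  intro i a
  set N := i.1 + i.2.1 with hN
  have hD : 1 ≤ i.2.1 := Fin.pos a.input.1.2
  have hL : 1 ≤ i.1 := Fin.pos a.input.2.1.2.1
  have hNM : N ≤ N ^ N := Nat.le_self_pow (by omega) N
  obtain ⟨s, hs, h1⟩ := hpi i a.input
  obtain ⟨t, ht, h2⟩ := hloop N N 1 (N ^ N) (by omega) hNM hNM (by omega)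
  have hsa : sz a = 2 * N ^ N + 2 + sz a.input := by
    change sz (N ^ N) + sz a.input = _
    rw [sz_nat]
  rw [a.sizeD, a.sizeL, ← hN] at h1
  rw [one_mul] at h2
  refine ⟨(s + (t + (1 + 1 + 1) + 1) + 1) + 1 + 1, ?_, ?_⟩
  · have hX := two_le_sz a.input
    generalize sz a = X at hsa ⊢
    have hX6 : 6 ≤ X := by omega
    have h3 : s ≤ X ^ (ki + 2 * kf) :=
      hs.trans ((hTi _ _).trans ((Nat.pow_le_pow_left (by omega) _).trans
        (Nat.pow_le_pow_right (by omega) (by omega))))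
    have h4 : (6 * N ^ N + 6) ^ kf ≤ X ^ (ki + 2 * kf) :=
      calc (6 * N ^ N + 6) ^ kf ≤ (X ^ 2) ^ kf := Nat.pow_le_pow_left (by nlinarith) _
        _ = X ^ (2 * kf) := (pow_mul _ _ _).symm
        _ ≤ _ := Nat.pow_le_pow_right (by omega) (by omega)
    have h5 : 1 ≤ X ^ (ki + 2 * kf) := Nat.pow_pos (by omega)
    have h6 : t ≤ X * (5 * X ^ (ki + 2 * kf)) :=
      ht.trans (Nat.mul_le_mul (by omega) (by omega))
    rw [pow_add]
    generalize X ^ (ki + 2 * kf) = Y at *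
    -- The total time is at most `36 * (Y * X ^ 2)`; the surplus factor `X ^ 3` absorbs the constant
    -- because `X ≥ 6`.
    have h8 : 36 * X ^ 2 ≤ X ^ 5 := by
      have : 36 ≤ X ^ 3 := le_trans (by norm_num) (Nat.pow_le_pow_left hX6 3)
      calc 36 * X ^ 2 ≤ X ^ 3 * X ^ 2 := Nat.mul_le_mul_right _ this
        _ = X ^ 5 := by ring
    have h9 : Y * (36 * X ^ 2) ≤ Y * X ^ 5 := Nat.mul_le_mul_left _ h8
    have h10 : X * Y ≤ Y * X ^ 2 := by rw [mul_comm]; exact Nat.mul_le_mul_left _ (by nlinarith)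
    have h11 : Y * 1 ≤ Y * X ^ 2 := Nat.mul_le_mul_left _ (by nlinarith)
    have h12 : X * (5 * Y) = 5 * (X * Y) := by ring
    have h13 : Y * (36 * X ^ 2) = 36 * (Y * X ^ 2) := by ring
    omega
  · have h3 := Prog.Runs.pair (.seq h1 (.seq h2 (.seq (.snd_cons _ _) (.fst_cons _ _))))
      (Prog.Runs.skip (toVal a.input))
    exact h3

/-! ## The size of the input -/

theorem sz_fin_le {n : ℕ} (a : Fin n) : sz a ≤ 2 * n := by
  have : sz a = sz a.val := rfl
  rw [this, sz_nat]
  omega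

/-- The absence of repetitions is decisive: it bounds the length by the number of possible
transitions, where a label is `ε`, a write or a read, `2 * D + 1` in all. -/
theorem sz_transitions_le {D Q : ℕ} {l : List (Fin Q × Option (MemOp (Fin D)) × Fin Q)}
    (hl : l.Nodup) : sz l ≤ 2 + Q * (2 * D + 1) * Q * (4 * Q + 2 * D + 6) := by
  have h1 : l.length ≤ Q * (2 * D + 1) * Q := by
    let f : Option (MemOp (Fin D)) → Option (Bool × Fin D) := Option.map fun o =>
      match o with
      | MemOp.wr a => (true, a)
      | MemOp.rd a => (false, a)
    have hf : Function.Injective f := by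
      refine Option.map_injective fun o o' h => ?_
      cases o <;> cases o' <;> simp_all
    have := (hl.map (f := fun t => (t.1, f t.2.1, t.2.2)) fun t t' h => by
      simp only [Prod.mk.injEq] at h
      exact Prod.ext h.1 (Prod.ext (hf h.2.1) h.2.2)).length_le_card
    simpa [Fintype.card_prod, Fintype.card_option, mul_assoc] using this
  refine (sz_list_le (m := 4 * Q + 2 * D + 6) ?_).trans
    (Nat.add_le_add_left (Nat.mul_le_mul_right _ h1) _)
  rintro ⟨q, o, q'⟩ _
  have h2 := sz_fin_le q
  have h3 := sz_fin_le q'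
  have h4 : sz o ≤ 2 * D + 6 := by
    rcases o with _ | a | a
    · rw [sz_none]; omega
    · have := sz_fin_le a
      change 2 + sz a + 2 ≤ _
      omega
    · have := sz_fin_le a
      change 2 + 2 + sz a + 2 ≤ _
      omega
  simp only [sz_prod]
  omega

theorem sz_transitions_le_pow {D Q X : ℕ} {l : List (Fin Q × Option (MemOp (Fin D)) × Fin Q)}
    (hl : l.Nodup) (hX : 4 ≤ X) (hD : D ≤ X) (hQ : Q ≤ X) : sz l ≤ 2 + X ^ 7 := by
  refine (sz_transitions_le hl).trans (Nat.add_le_add_left ?_ 2)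
  calc Q * (2 * D + 1) * Q * (4 * Q + 2 * D + 6) ≤ X * X ^ 2 * X * X ^ 3 := by
        refine Nat.mul_le_mul (Nat.mul_le_mul (Nat.mul_le_mul hQ ?_) hQ) ?_
        · nlinarith
        · have : 16 * X ≤ X ^ 3 := by rw [pow_succ]; exact Nat.mul_le_mul_right _ (by nlinarith)
          omega
    _ = X ^ 7 := by ring

/-- The padding and all three sizes are at most `X = (L + D) ^ (L + D) * C`, where `C ≥ 1` because
of the initial contributor state. Each transition list has size at most `2 + X ^ 7`, and `X ≥ 4`
leaves room for the sum below `X ^ 9`. -/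
theorem PaddedInput.sz_le {i : ℕ × ℕ × ℕ} (a : PaddedInput i) (hC : a.input.2.2.1 = i.2.2)
    (hTL : a.input.2.1.2.2.Nodup) (hTC : a.input.2.2.2.2.Nodup) :
    sz a ≤ ((i.1 + i.2.1) ^ (i.1 + i.2.1) * i.2.2) ^ 9 := by
  obtain ⟨L, D, C⟩ := i
  obtain ⟨⟨⟨n, m0⟩, ⟨l, qL, TL⟩, c, qC, TC⟩, sD, sL⟩ := a
  dsimp only at sD sL hC hTL hTC m0 qL qC ⊢
  subst sD sL hC
  have h1 : sz (PaddedInput.mk (i := (l, n, c)) ((n, m0), (l, qL, TL), c, qC, TC) rfl rfl) =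
      sz ((l + n) ^ (l + n)) + (sz n + sz m0 + (sz l + (sz qL + sz TL) +
        (sz c + (sz qC + sz TC)))) := rfl
  have hn : 1 ≤ n := Fin.pos m0
  have hl : 1 ≤ l := Fin.pos qL
  have hc : 1 ≤ c := Fin.pos qC
  have h2 : 4 ≤ (l + n) ^ (l + n) :=
    calc 4 = 2 ^ 2 := rfl
      _ ≤ (l + n) ^ 2 := Nat.pow_le_pow_left (by omega) 2
      _ ≤ _ := Nat.pow_le_pow_right (by omega) (by omega)
  have h3 : l + n ≤ (l + n) ^ (l + n) := Nat.le_self_pow (by omega) _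
  have h4 : (l + n) ^ (l + n) ≤ (l + n) ^ (l + n) * c := Nat.le_mul_of_pos_right _ hc
  have h5 : c ≤ (l + n) ^ (l + n) * c := Nat.le_mul_of_pos_left _ (by omega)
  rw [h1]
  simp only [sz_nat]
  generalize (l + n) ^ (l + n) * c = X at *
  generalize (l + n) ^ (l + n) = M at *
  have e1 := sz_transitions_le_pow (D := n) (Q := l) (X := X) hTL (by omega) (by omega) (by omega)
  have e2 := sz_transitions_le_pow (D := n) (Q := c) (X := X) hTC (by omega) (by omega) (by omega)
  have e3 := sz_fin_le m0
  have e4 := sz_fin_le qL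
  have e5 := sz_fin_le qC
  dsimp only at *
  have e6 : X * 1 ≤ X * X ^ 6 := Nat.mul_le_mul_left _ (Nat.pow_pos (by omega))
  have e7 : X ^ 9 = X * X * (X * X ^ 6) := by ring
  have e8 : 16 * (X * X ^ 6) ≤ X * X * (X * X ^ 6) := Nat.mul_le_mul_right _ (by nlinarith)
  have e9 : X ^ 7 = X * X ^ 6 := by ring
  have e10 : 4 ^ 6 ≤ X ^ 6 := Nat.pow_le_pow_left (by omega) 6
  have e11 : 4 * 4 ^ 6 ≤ X * X ^ 6 := Nat.mul_le_mul (by omega) e10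
  have e12 : X * 4 ^ 6 ≤ X * X ^ 6 := Nat.mul_le_mul_left _ e10
  omega

/-! ### The main theorem -/

theorem mainTheorem7 :
    ∃ (p : Prog) (c : ℕ), ∀ (L D C : ℕ) (S : LCSystem (Fin D) (Fin L) (Fin C))
      (transL : List (Fin L × Option (MemOp (Fin D)) × Fin L))
      (transC : List (Fin C × Option (MemOp (Fin D)) × Fin C)),
      IsListing S.leader.trans transL → IsListing S.contrib.trans transC →
      ∃ (out : List (List (Fin D) × Witness (Fin D) (Fin L))) (t : ℕ),
        IsListing S.validShortWitnesses out ∧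
        p.Runs (S.encode transL transC) (ToVal.toVal out) t ∧
        t ≤ (L + D) ^ (c * (L + D)) * C ^ c := by
  obtain ⟨p, T, ⟨c, hc⟩, hp⟩ := polyTime_validList.runs
  obtain ⟨q, d, hq⟩ := exists_pad_prog
  -- The exponents `d` and `c` bound padding and computation in the padded size, `2` absorbs their
  -- sum and the extra step, and `9` converts the padded size into `(L + D) ^ (L + D) * C`.
  refine ⟨.seq q p, 9 * (c + d + 2), fun L D C S transL transC hL hC => ?_⟩
  let a : PaddedInput (L, D, C) :=
    ⟨((D, S.initMem), (L, S.leader.start, transL), (C, S.contrib.start, transC)), rfl, rfl⟩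
  obtain ⟨s, hs, h1⟩ := hq _ a
  obtain ⟨t, ht, h2⟩ := hp _ a
  refine ⟨_, s + t + 1, isListing_validList List.mem_finRange (List.nodup_finRange D)
    List.mem_finRange (List.nodup_finRange L) hL.2 hC.2, .seq h1 h2, ?_⟩
  have h3 := a.sz_le rfl hL.1 hC.1
  have h4 := two_le_sz a
  have h5 : s + t + 1 ≤ sz a ^ (c + d + 2) := by
    have e1 : s ≤ sz a ^ (c + d) := hs.trans (Nat.pow_le_pow_right (by omega) (by omega))
    have e2 : t ≤ sz a ^ (c + d) :=
      ht.trans ((hc _ _).trans (Nat.pow_le_pow_right (by omega) (by omega)))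
    have e3 : 1 ≤ sz a ^ (c + d) := Nat.pow_pos (by omega)
    have e4 : sz a ^ (c + d) * 2 ^ 2 ≤ sz a ^ (c + d) * sz a ^ 2 :=
      Nat.mul_le_mul_left _ (Nat.pow_le_pow_left h4 2)
    rw [pow_add]
    omega
  calc s + t + 1 ≤ (((L + D) ^ (L + D) * C) ^ 9) ^ (c + d + 2) :=
        h5.trans (Nat.pow_le_pow_left h3 _)
    _ = (L + D) ^ (9 * (c + d + 2) * (L + D)) * C ^ (9 * (c + d + 2)) := by
        rw [← pow_mul, mul_pow, ← pow_mul, Nat.mul_comm (L + D)]
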